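/- Let $H$ be an infinite-dimensional separable (real or complex) Hilbert space with norm $|\cdot|$, and let $A$ be a self-adjoint, strictly negative operator with domain $D(A)\subset H$ for which there is an orthonormal basis $(e_n)_{n\in\mathbb N_0}$ of $H$ with $e_n\in D(A)$, $Ae_n=-\lambda_n e_n$, $0<\lambda_0\le\lambda_1\le\cdots$ and $\lambda_n\to\infty$. Let $(S(t))_{t\ge0}$ be the $C_0$-semigroup generated by $A$. Let $L_2(H,H)$ be the space of Hilbert–Schmidt operators on $H$ with the Hilbert–Schmidt norm $\|\cdot\|$, and let $\nu$ be a Lévy measure on $L_2(H,H)$ (that is, $\nu(\{0\})=0$ and $\int\min(1,\|z\|^2)\,\nu(\mathrm dz)<\infty$) whose support consists of operators that are diagonal with respect to $(e_n)$. Let $N$ be a Poisson random measure on $[0,\infty)\times L_2(H,H)$ with intensity $\mathrm dt\otimes\nu$, on a filtered probability space satisfying the usual conditions, and $\widetilde N=N-\mathrm dt\otimes\nu$ its compensated measure. Fix $\eta\in(0,1)$, and for $\varepsilon\in(0,1)$ let $\mathcal X^{(\eta,\varepsilon)}$ be the adapted, (strongly) càdlàg process of bounded operators on $H$ that is the mild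 solution of $$\mathrm d\mathcal X_t=A\mathcal X_t\,\mathrm dt+\varepsilon\int_{\eta\le\|z\|<1}z\,\mathcal X_{t-}\,\widetilde N(\mathrm dz,\mathrm dt),\qquad \mathcal X_0=I,$$ that is, almost surely, for all $t\ge0$ and all $g\in H$, $$\mathcal X_t(g)=S(t)g+\varepsilon\int_0^t\int_{\eta\le\|z\|<1}S(t-s)\,z\,\mathcal X_{s-}(g)\,\widetilde N(\mathrm dz,\mathrm ds).$$ Let $h\in D(A)$, $h\ne0$, and put $N_h=\min\{k:\langle e_k,h\rangle\ne0\}$ and $v_h=\sum_{k:\,\lambda_k=\lambda_{N_h}}\langle e_k,h\rangle e_k$. Then $v_h\neq 0$ and $e^{\lambda_{N_h}t}S(t)h\to v_h$ as $t\to\infty$. Let $(a_\varepsilon)_{\varepsilon\in(0,1)}$ be positive with $$\lim_{\varepsilon\to0}a_\varepsilon=\lim_{\varepsilon\to0}\varepsilon|\ln a_\varepsilon|=0,$$ and let $t_\varepsilon=|\ln a_\varepsilon|/\lambda_{N_h}$. Then for every $\varrho\in\mathbb R$, $$\lim_{\varepsilon\to0}\frac{\mathcal W_2\big(\mathcal X^{(\eta,\varepsilon)}_{t_\varepsilon+\varrho}(h),\delta_0\big)}{a_\varepsilon}=e^{-\lambda_{N_h}\varrho}\,|v_h|,$$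 where $\mathcal W_2$ is the Wasserstein distance of order $2$ between the law of the first argument and the Dirac measure $\delta_0$ at $0\in H$. -/

import Mathlib

open MeasureTheory ProbabilityTheory Filter Set
open scoped Topology NNReal ENNReal InnerProductSpace

noncomputable section

/-! ### Hilbert-Schmidt operators -/

section HilbertSchmidt

variable {𝕜 H : Type*} [RCLike 𝕜] [NormedAddCommGroup H] [InnerProductSpace 𝕜 H]

/-- The Hilbert-Schmidt operators on `H`: the bounded operators `T` with `∑ j, ‖T (e j)‖ ^ 2 < ∞`.
Neither this condition nor the value of the sum depends on the orthonormal basis `e`. -/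
def hilbertSchmidtSubmodule (e : HilbertBasis ℕ 𝕜 H) : Submodule 𝕜 (H →L[𝕜] H) where
  carrier := {T | Memℓp (fun j => T (e j)) 2}
  add_mem' := fun hS hT => hS.add hT
  zero_mem' := zero_memℓp
  smul_mem' := fun c _ hT => hT.const_smul c

/-- The space `L₂(H, H)` of Hilbert-Schmidt operators. It is a separate type, so that it carries
the Hilbert-Schmidt norm and not the operator norm. -/
def HilbertSchmidt (e : HilbertBasis ℕ 𝕜 H) : Type _ := hilbertSchmidtSubmodule e

namespace HilbertSchmidt

variable {e : HilbertBasis ℕ 𝕜 H}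

instance : AddCommGroup (HilbertSchmidt e) :=
  inferInstanceAs (AddCommGroup (hilbertSchmidtSubmodule e))

instance : Module 𝕜 (HilbertSchmidt e) :=
  inferInstanceAs (Module 𝕜 (hilbertSchmidtSubmodule e))

/-- The bounded operator underlying a Hilbert-Schmidt operator. -/
def toCLM (T : HilbertSchmidt e) : H →L[𝕜] H := T.val

/-- The sequence `(T (e j))_j` as an element of `ℓ²(ℕ, H)`. -/
def toLp (e : HilbertBasis ℕ 𝕜 H) : HilbertSchmidt e →ₗ[𝕜] lp (fun _ : ℕ => H) 2 where
  toFun T := ⟨fun j => T.toCLM (e j), T.property⟩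
  map_add' _ _ := rfl
  map_smul' _ _ := rfl

lemma toLp_injective : Function.Injective (toLp e) := by
  intro S T h
  refine Subtype.ext (ContinuousLinearMap.ext_on (s := Set.range e) ?_ ?_)
  · have := e.dense_span
    rw [Submodule.dense_iff_topologicalClosure_eq_top]
    exact this
  · rintro _ ⟨j, rfl⟩
    exact congrFun (congrArg Subtype.val h) j

/-- The Hilbert-Schmidt norm `‖T‖ = (∑ j, ‖T (e j)‖ ^ 2) ^ (1 / 2)`. -/
instance : NormedAddCommGroup (HilbertSchmidt e) :=
  NormedAddCommGroup.induced (HilbertSchmidt e) (lp (fun _ : ℕ => H) 2) (toLp e) toLp_injective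

instance : NormedSpace 𝕜 (HilbertSchmidt e) :=
  NormedSpace.induced 𝕜 (HilbertSchmidt e) (lp (fun _ : ℕ => H) 2) (toLp e)

lemma norm_sq (T : HilbertSchmidt e) : ‖T‖ ^ 2 = ∑' j, ‖T.toCLM (e j)‖ ^ 2 := by
  have h := lp.norm_rpow_eq_tsum (p := 2) (by norm_num) (toLp e T)
  simp only [ENNReal.toReal_ofNat, Real.rpow_ofNat] at h
  exact h

instance : MeasurableSpace (HilbertSchmidt e) := borel _

instance : BorelSpace (HilbertSchmidt e) := ⟨rfl⟩

/-- `T` is a diagonal operator with respect to the basis `e`. -/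
def IsDiagonal (T : HilbertSchmidt e) : Prop := ∀ j, ∃ c : 𝕜, T.toCLM (e j) = c • e j

/-- The operators with `η ≤ ‖z‖ < 1`. -/
def annulus (e : HilbertBasis ℕ 𝕜 H) (η : ℝ) : Set (HilbertSchmidt e) := {z | η ≤ ‖z‖ ∧ ‖z‖ < 1}

end HilbertSchmidt

end HilbertSchmidt

/-! ### The operator `A` and its semigroup -/

section Semigroup

-- The real scalar multiplication of `H` is automatically compatible with that of `𝕜`, as it is
-- determined by addition and the topology.
variable {𝕜 H : Type*} [RCLike 𝕜] [NormedAddCommGroup H] [InnerProductSpace 𝕜 H]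
  [NormedSpace ℝ H] [CompleteSpace H]

/-- The (unbounded) operator `A` is self-adjoint and strictly negative, and the orthonormal basis
`e` consists of eigenvectors `A (e n) = - lam n • e n` with `0 < lam 0 ≤ lam 1 ≤ … → ∞`. -/
structure IsNegativeWithEigenbasis (A : H →ₗ.[𝕜] H) (e : HilbertBasis ℕ 𝕜 H)
    (lam : ℕ → ℝ) : Prop where
  isSelfAdjoint : IsSelfAdjoint A
  strictly_negative : ∀ x : A.domain, (x : H) ≠ 0 → RCLike.re ⟪A x, (x : H)⟫_𝕜 < 0
  mem_domain : ∀ n, e n ∈ A.domain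
  eigenvector : ∀ n, A ⟨e n, mem_domain n⟩ = -(lam n : 𝕜) • e n
  pos : 0 < lam 0
  mono : Monotone lam
  tendsto : Tendsto lam atTop atTop

/-- `S` is a strongly continuous semigroup of bounded operators with infinitesimal generator `A`:
the graph of `A` is the set of all `(x, y)` with `(S t x - x) / t → y` as `t ↓ 0`. -/
structure IsC0SemigroupGeneratedBy (S : ℝ≥0 → H →L[𝕜] H) (A : H →ₗ.[𝕜] H) : Prop where
  zero : S 0 = ContinuousLinearMap.id 𝕜 H
  add : ∀ s t, S (s + t) = (S s).comp (S t)
  continuous : ∀ x, Continuous fun t => S t x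
  generator : ∀ x y, (x, y) ∈ A.graph ↔
    Tendsto (fun t : ℝ≥0 => (t : ℝ)⁻¹ • (S t x - x)) (𝓝[>] 0) (𝓝 y)

/-- The smallest index `k` with `⟪e k, h⟫ ≠ 0` (for `h ≠ 0`). -/
def leadingIndex (e : HilbertBasis ℕ 𝕜 H) (h : H) : ℕ := sInf {k | ⟪e k, h⟫_𝕜 ≠ 0}

/-- The indices `k` with `⟪e k, h⟫ ≠ 0` whose eigenvalue is the one of the leading index. -/
def leadingSet (e : HilbertBasis ℕ 𝕜 H) (lam : ℕ → ℝ) (h : H) : Set ℕ :=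
  {k | ⟪e k, h⟫_𝕜 ≠ 0 ∧ lam k = lam (leadingIndex e h)}

/-- The leading part `∑ ⟪e k, h⟫ • e k` of `h`, summed over the leading set (a finite set when
`lam` tends to infinity). -/
def leadingVector (e : HilbertBasis ℕ 𝕜 H) (lam : ℕ → ℝ) (h : H) : H :=
  ∑' k : leadingSet e lam h, ⟪e (k : ℕ), h⟫_𝕜 • e (k : ℕ)

end Semigroup

/-! ### Lévy measures and Poisson random measures -/

/-- `ν` is a Lévy measure: it has no mass at `0` and integrates `min 1 (‖z‖ ^ 2)`. -/
structure IsLevyMeasure {E : Type*} [NormedAddCommGroup E] [MeasurableSpace E]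
    (ν : Measure E) : Prop where
  zero : ν {0} = 0
  integral_lt_top : ∫⁻ z, min 1 (‖z‖ₑ ^ 2) ∂ν < ∞

/-- The usual conditions: the filtration is right-continuous and its members contain all
null sets. -/
structure UsualConditions {Ω : Type*} [MeasurableSpace Ω] (P : Measure Ω)
    (𝓕 : Filtration ℝ≥0 ‹MeasurableSpace Ω›) : Prop where
  complete : ∀ s : Set Ω, P s = 0 → MeasurableSet[𝓕 0] s
  right_continuous : 𝓕.IsRightContinuous

/-- Lebesgue measure on the time axis `[0, ∞)`. -/
def timeMeasure : Measure ℝ≥0 := (volume : Measure ℝ).comap (fun t : ℝ≥0 => (t : ℝ))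

/-- `N` is a Poisson random measure on `[0, ∞) × E` with intensity `dt ⊗ ν`, with respect to the
filtration `𝓕`: an integer-valued random measure such that `N B` is Poisson distributed with
parameter `(dt ⊗ ν) B` whenever this is finite, such that the values on disjoint sets are
independent, and such that `N` is `𝓕 t`-measurable on `[0, t] × E` and independent of `𝓕 t`
on `(t, ∞) × E`. -/
structure IsPoissonRandomMeasure {Ω E : Type*} [MeasurableSpace Ω] [MeasurableSpace E]
    (P : Measure Ω) (𝓕 : Filtration ℝ≥0 ‹MeasurableSpace Ω›) (ν : Measure E)
    (N : Ω → Measure (ℝ≥0 × E)) : Prop where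
  measurable : ∀ B, MeasurableSet B → Measurable fun ω => N ω B
  integer_valued : ∀ᵐ ω ∂P, ∀ B, MeasurableSet B → ∃ n : ℕ∞, N ω B = (n : ℝ≥0∞)
  poisson : ∀ B, MeasurableSet B → (timeMeasure.prod ν) B ≠ ∞ →
    P.map (fun ω => N ω B) =
      (poissonMeasure ((timeMeasure.prod ν) B).toNNReal).map (fun n : ℕ => (n : ℝ≥0∞))
  indep : ∀ (n : ℕ) (B : Fin n → Set (ℝ≥0 × E)), (∀ i, MeasurableSet (B i)) →
    Pairwise (fun i j => Disjoint (B i) (B j)) → iIndepFun (fun i ω => N ω (B i)) P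
  adapted : ∀ t B, MeasurableSet B → B ⊆ Set.Iic t ×ˢ Set.univ →
    Measurable[𝓕 t] fun ω => N ω B
  indep_future : ∀ t, Indep (𝓕 t)
    (⨆ B : {B : Set (ℝ≥0 × E) // MeasurableSet B ∧ B ⊆ Set.Ioi t ×ˢ Set.univ},
      MeasurableSpace.comap (fun ω => N ω B) inferInstance) P

/-- The integral of `f` over `B` with respect to the compensated measure `n - Λ`, for a set `B` to
which both the realization `n` of a random measure and its compensator `Λ` give finite mass. -/
def compensatedIntegral {E G : Type*} [MeasurableSpace E] [NormedAddCommGroup G] [NormedSpace ℝ G]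
    (n Λ : Measure E) (B : Set E) (f : E → G) : G :=
  (∫ p in B, f p ∂n) - ∫ p in B, f p ∂Λ

/-! ### The mild solution -/

/-- The path `f` is right-continuous with left limits. -/
def IsCadlagPath {G : Type*} [TopologicalSpace G] (f : ℝ≥0 → G) : Prop :=
  ∀ t, ContinuousWithinAt f (Set.Ici t) t ∧ ∃ l, Tendsto f (𝓝[<] t) (𝓝 l)

/-- `X` is a mild solution, with initial value the identity, of the operator-valued equation
`dX = A X dt + ε ∫_{η ≤ ‖z‖ < 1} z X_{t-} Ñ(dz, dt)`, where `S` is the semigroup generated by `A`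
and `Ñ = N - dt ⊗ ν`. Operator-valued processes are read in the strong operator sense,
that is, by evaluation at the vectors `h` of `H`. As `η > 0`, the measure `N` has almost surely only
finitely many points in `(0, t] × {η ≤ ‖z‖ < 1}`, and the stochastic integral is a pathwise one. -/
structure IsMildSolution {𝕜 H Ω : Type*} [RCLike 𝕜] [NormedAddCommGroup H] [InnerProductSpace 𝕜 H]
    [NormedSpace ℝ H] [MeasurableSpace Ω] {e : HilbertBasis ℕ 𝕜 H}
    (P : Measure Ω) (𝓕 : Filtration ℝ≥0 ‹MeasurableSpace Ω›) (S : ℝ≥0 → H →L[𝕜] H)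
    (ν : Measure (HilbertSchmidt e)) (N : Ω → Measure (ℝ≥0 × HilbertSchmidt e)) (η ε : ℝ)
    (X : ℝ≥0 → Ω → H →L[𝕜] H) : Prop where
  adapted : ∀ h, StronglyAdapted 𝓕 fun t ω => X t ω h
  cadlag : ∀ᵐ ω ∂P, ∀ h, IsCadlagPath fun t => X t ω h
  mild : ∀ᵐ ω ∂P, ∀ t h,
    X t ω h = S t h + ε •
      compensatedIntegral (N ω) (timeMeasure.prod ν) (Set.Ioc 0 t ×ˢ HilbertSchmidt.annulus e η)
        (fun p => S (t - p.1) (p.2.toCLM (Function.leftLim (fun s => X s ω h) p.1)))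

/-! ### The Wasserstein distance -/

/-- The Wasserstein distance of order `p`: the infimum over all couplings `π` of `μ₁` and `μ₂` of
`(∫ ‖u - v‖ ^ p dπ) ^ min 1 (1 / p)`. -/
def wassersteinDist {G : Type*} [NormedAddCommGroup G] [MeasurableSpace G] (p : ℝ)
    (μ₁ μ₂ : Measure G) : ℝ≥0∞ :=
  ⨅ (π : Measure (G × G)) (_ : π.map Prod.fst = μ₁ ∧ π.map Prod.snd = μ₂),
    (∫⁻ q, ‖q.1 - q.2‖ₑ ^ p ∂π) ^ min 1 (1 / p)

end

/-! ### A Gronwall inequality for integrals of left limits -/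

/-! Diagonal noise decouples the equation. The coordinate `x_k` of `X_t h` along `e k` solves a
scalar linear equation driven by the diagonal entries `z_k`, with `|z_k| ≤ ‖z‖ < 1` on the annulus.
Multiplied by `exp (λ_k t)`, its semigroup term becomes the constant `⟪e k, h⟫`, and the noise term
is at most `ε` times the integral of the left limits of `exp (λ_k s) |x_k|` against `μ`, the
projection to time of `N + dt ⊗ ν` restricted to the annulus. Since `η > 0`, `μ (0, t]` is almost
surely finite, so no stochastic calculus is needed: the compensated integral is estimated pathwise
by the triangle inequality.

A Gronwall inequality for measures with atoms (`gronwall_left_limits`) then bounds the deviation of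
each coordinate by `exp (2 ε Y) - 1` times the corresponding coordinate of `S t h`, where `Y = μ (0,
t]`. This factor does not depend on `k`, so Parseval gives `‖X_t h - S t h‖ ≤ (exp (2 ε Y) - 1) ‖S t
h‖` (`norm_sub_semigroup_le`). It is essential that the error is relative to `‖S t h‖`, which itself
decays exponentially.

Since `Y` is a Poisson variable plus its mean `t κ`, with `κ` the mass of the annulus, `E exp (b Y)
= exp (t κ (b + exp b - 1))`. For `b` of order `ε` this tends to `1` whenever `ε t → 0`, which holds
at the cutoff times because `ε |log a| → 0`. Hence `E ‖X_t h‖²` is asymptotic to `‖S t h‖²`. The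
Wasserstein distance to `δ₀` is the root of this second moment, and the deterministic limit of `exp
(L t) • S t h`, with `L` the leading eigenvalue of `h`, identifies the constant. -/

lemma measure_lt_measure_Iio_le (m : Measure ℝ≥0) [IsFiniteMeasure m] (u : ℝ≥0∞) :
    m {s | u < m (Iio s)} ≤ m univ - u := by
  have hmeas : MeasurableSet {s | u < m (Iio s)} :=
    (show Monotone fun s => m (Iio s) from fun a b hab => measure_mono (Iio_subset_Iio hab)).measurable
      measurableSet_Ioi
  -- The set is an up-set that may lack a minimum. A nonempty compact subset has one, say `s`, and
  -- lies in `Ici s`, whose complement already has mass more than `u`.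
  rw [hmeas.measure_eq_iSup_isCompact]
  refine iSup₂_le fun K hK => iSup_le fun hKc => ?_
  rcases K.eq_empty_or_nonempty with rfl | hne
  · simp
  obtain ⟨s, hs, hmin⟩ := hKc.exists_isLeast hne
  have h1 : m K ≤ m (Ici s) := measure_mono fun x hx => hmin hx
  refine h1.trans ?_
  rw [← compl_Iio, measure_compl measurableSet_Iio (measure_ne_top _ _)]
  exact tsub_le_tsub_left (hK hs).le _

/-- Substitute for the chain rule `θ exp (θ F) dF = d exp (θ F)` when the distribution function `F`
may jump: evaluating it on the open ray, before the jump, leaves an inequality in the right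
direction. The layer cake formula reduces it to the preceding bound on superlevel sets. -/
lemma lintegral_exp_measure_Iio_le (m : Measure ℝ≥0) [IsFiniteMeasure m] {θ : ℝ} (hθ : 0 < θ) :
    ENNReal.ofReal θ * ∫⁻ s, ENNReal.ofReal (Real.exp (θ * m.real (Iio s))) ∂m ≤
      ENNReal.ofReal (Real.exp (θ * m.real univ) - 1) := by
  set F : ℝ := m.real univ with hF
  have hF0 : 0 ≤ F := measureReal_nonneg
  have hmono : Monotone fun s => m.real (Iio s) := fun a b hab =>
    measureReal_mono (Iio_subset_Iio hab)
  -- Antiderivative of the layer cake integrand once the mass of the superlevel set has been bounded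
  -- by `F - t`.
  have hderiv : ∀ r u : ℝ, HasDerivAt (fun u => (r - u) * Real.exp (θ * u) + Real.exp (θ * u) / θ)
      ((r - u) * (θ * Real.exp (θ * u))) u := by
    intro r u
    have h1 : HasDerivAt (fun u => Real.exp (θ * u)) (Real.exp (θ * u) * (θ * 1)) u :=
      ((hasDerivAt_id u).const_mul θ).exp
    have h2 : HasDerivAt (fun u : ℝ => r - u) (-1) u := by
      simpa using (hasDerivAt_id u).const_sub r
    convert! (h2.mul h1).add (h1.div_const θ) using 1
    field_simp
    ring
  have hint : ∀ r : ℝ, ∫ t in (0 : ℝ)..r, θ * Real.exp (θ * t) = Real.exp (θ * r) - 1 := by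
    intro r
    rw [intervalIntegral.integral_eq_sub_of_hasDerivAt (f := fun t => Real.exp (θ * t))]
    · simp
    · intro t _
      simpa [mul_comm] using ((hasDerivAt_id t).const_mul θ).exp
    · exact (by fun_prop : Continuous fun t => θ * Real.exp (θ * t)).intervalIntegrable _ _
  have hlayer := lintegral_comp_eq_lintegral_meas_lt_mul m (f := fun s => m.real (Iio s))
    (g := fun t => θ * Real.exp (θ * t)) (ae_of_all _ fun _ => measureReal_nonneg)
    hmono.measurable.aemeasurable
    (fun t _ => (by fun_prop : Continuous fun t => θ * Real.exp (θ * t)).intervalIntegrable _ _)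
    (ae_of_all _ fun _ => by positivity)
  simp only [hint] at hlayer
  have hbound : ∫⁻ t in Ioi (0 : ℝ), m {a | t < m.real (Iio a)} *
      ENNReal.ofReal (θ * Real.exp (θ * t)) ≤
      ENNReal.ofReal (Real.exp (θ * F) / θ - F - 1 / θ) := by
    have h1 : ∀ t ∈ Ioi (0 : ℝ), m {a | t < m.real (Iio a)} *
        ENNReal.ofReal (θ * Real.exp (θ * t)) ≤
        (Ioc 0 F).indicator (fun t => ENNReal.ofReal ((F - t) * (θ * Real.exp (θ * t)))) t := by
      intro t ht
      have ht0 : (0 : ℝ) < t := ht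
      have hle : m {a | t < m.real (Iio a)} ≤ ENNReal.ofReal (F - t) := by
        have : {a | t < m.real (Iio a)} = {a | ENNReal.ofReal t < m (Iio a)} := by
          ext a
          simp only [mem_ofPred_eq, measureReal_def]
          rw [ENNReal.ofReal_lt_iff_lt_toReal ht0.le (measure_ne_top _ _)]
        rw [this]
        refine (measure_lt_measure_Iio_le m _).trans_eq ?_
        rw [ENNReal.ofReal_sub _ ht0.le, hF, ofReal_measureReal]
      by_cases htF : t ≤ F
      · rw [indicator_of_mem (mem_Ioc.2 ⟨ht0, htF⟩)]
        refine (mul_le_mul' hle le_rfl).trans_eq ?_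
        rw [← ENNReal.ofReal_mul (sub_nonneg.2 htF)]
      · rw [ENNReal.ofReal_of_nonpos (by linarith)] at hle
        rw [le_antisymm hle zero_le]
        simp
    refine (setLIntegral_mono' measurableSet_Ioi h1).trans ?_
    rw [lintegral_indicator measurableSet_Ioc, Measure.restrict_restrict measurableSet_Ioc,
      inter_eq_left.2 (fun x hx => hx.1)]
    have hcont : Continuous fun t => (F - t) * (θ * Real.exp (θ * t)) := by fun_prop
    rw [← ofReal_integral_eq_lintegral_ofReal]
    · rw [← intervalIntegral.integral_of_le hF0,
        intervalIntegral.integral_eq_sub_of_hasDerivAt (fun u _ => hderiv F u)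
          (hcont.intervalIntegrable _ _)]
      apply ENNReal.ofReal_le_ofReal
      simp
    · exact (hcont.intervalIntegrable 0 F).1
    · filter_upwards [ae_restrict_mem measurableSet_Ioc] with t ht
      have : 0 ≤ F - t := by linarith [ht.2]
      positivity
  have hsplit : ∀ s, ENNReal.ofReal (Real.exp (θ * m.real (Iio s))) =
      1 + ENNReal.ofReal (Real.exp (θ * m.real (Iio s)) - 1) := by
    intro s
    have h0 : 0 ≤ Real.exp (θ * m.real (Iio s)) - 1 := by
      have : 0 ≤ θ * m.real (Iio s) := mul_nonneg hθ.le measureReal_nonneg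
      linarith [Real.one_le_exp this]
    rw [← ENNReal.ofReal_one, ← ENNReal.ofReal_add zero_le_one h0]
    congr 1
    ring
  simp_rw [hsplit]
  rw [lintegral_add_left measurable_const, hlayer, lintegral_one]
  calc ENNReal.ofReal θ * (m univ + _)
      ≤ ENNReal.ofReal θ * (ENNReal.ofReal F + ENNReal.ofReal (Real.exp (θ * F) / θ - F - 1 / θ)) := by
        gcongr
        rw [hF, ofReal_measureReal]
    _ = ENNReal.ofReal (Real.exp (θ * F) - 1) := by
        have h0 : 0 ≤ Real.exp (θ * F) / θ - F - 1 / θ := by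
          have := Real.add_one_le_exp (θ * F)
          have h2 : Real.exp (θ * F) / θ - F - 1 / θ = (Real.exp (θ * F) - (θ * F + 1)) / θ := by
            field_simp
            ring
          rw [h2]
          exact div_nonneg (by linarith) hθ.le
        rw [← ENNReal.ofReal_add hF0 h0, ← ENNReal.ofReal_mul hθ.le]
        congr 1
        field_simp
        ring

/-- A Gronwall inequality: `g` stands for the left limits of `u`, which only enter through
bounds that they inherit from `u`. -/
lemma gronwall_left_limits (μ : Measure ℝ≥0) (T : ℝ≥0) (hT : μ (Ioc 0 T) ≠ ∞) (u g : ℝ≥0 → ℝ)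
    (hg : ∀ s ∈ Ioc 0 T, ∀ K, (∀ r < s, u r ≤ K) → g s ≤ K)
    {R : ℝ} (hR : ∀ s ≤ T, u s ≤ R) {C ε : ℝ} (hC : 0 ≤ C) (hε : 0 < ε)
    (hu0 : ∀ s, 0 ≤ u s)
    (hu : ∀ t ≤ T, ENNReal.ofReal (u t) ≤
      ENNReal.ofReal C + ENNReal.ofReal ε * ∫⁻ s in Ioc 0 t, ENNReal.ofReal (g s) ∂μ) :
    ENNReal.ofReal ε * ∫⁻ s in Ioc 0 T, ENNReal.ofReal (g s) ∂μ ≤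
      ENNReal.ofReal (C * (Real.exp (2 * ε * μ.real (Ioc 0 T)) - 1)) := by
  have hfin : ∀ t ≤ T, μ (Ioc 0 t) ≠ ∞ := fun t ht =>
    ne_top_of_le_ne_top hT (measure_mono (Ioc_subset_Ioc_right ht))
  -- Taking the rate `2 * ε` rather than `ε` in the exponential produces the factor `1 / 2`, which
  -- makes the estimate a contraction in `K`.
  have key : ∀ K, 0 ≤ K → (∀ s ≤ T, u s ≤ K * Real.exp (2 * ε * μ.real (Ioc 0 s))) →
      ∀ t ≤ T, ENNReal.ofReal ε * ∫⁻ s in Ioc 0 t, ENNReal.ofReal (g s) ∂μ ≤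
        ENNReal.ofReal (K / 2 * (Real.exp (2 * ε * μ.real (Ioc 0 t)) - 1)) := by
    intro K hK hKu t ht
    have : IsFiniteMeasure (μ.restrict (Ioc 0 t)) := ⟨by simpa using (hfin t ht).lt_top⟩
    have h1 : ∫⁻ s in Ioc 0 t, ENNReal.ofReal (g s) ∂μ ≤
        ∫⁻ s in Ioc 0 t, ENNReal.ofReal K *
          ENNReal.ofReal (Real.exp (2 * ε * (μ.restrict (Ioc 0 t)).real (Iio s))) ∂μ := by
      refine setLIntegral_mono' measurableSet_Ioc fun s hs => ?_
      rw [← ENNReal.ofReal_mul hK]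
      refine ENNReal.ofReal_le_ofReal (hg s ⟨hs.1, hs.2.trans ht⟩ _ fun r hr => ?_)
      refine (hKu r (hr.le.trans (hs.2.trans ht))).trans ?_
      gcongr
      rw [measureReal_restrict_apply measurableSet_Iio]
      exact measureReal_mono (fun x hx => ⟨lt_of_le_of_lt hx.2 hr, hx.1, hx.2.trans (hr.le.trans hs.2)⟩)
        (ne_top_of_le_ne_top (hfin t ht) (measure_mono inter_subset_right))
    rw [lintegral_const_mul'] at h1
    swap
    · exact ENNReal.ofReal_ne_top
    have h2 := lintegral_exp_measure_Iio_le (μ.restrict (Ioc 0 t)) (θ := 2 * ε) (by positivity)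
    rw [measureReal_restrict_apply MeasurableSet.univ, univ_inter] at h2
    have hE : ENNReal.ofReal ε * ENNReal.ofReal K =
        ENNReal.ofReal (K / 2) * ENNReal.ofReal (2 * ε) := by
      rw [← ENNReal.ofReal_mul hε.le, ← ENNReal.ofReal_mul (by positivity)]
      congr 1
      ring
    calc _ ≤ ENNReal.ofReal ε * (ENNReal.ofReal K * _) := by gcongr
      _ = ENNReal.ofReal (K / 2) * (ENNReal.ofReal (2 * ε) * _) := by
          rw [← mul_assoc, hE, mul_assoc]
      _ ≤ _ := by
          refine (mul_le_mul' le_rfl h2).trans_eq ?_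
          rw [← ENNReal.ofReal_mul (by positivity)]
  have hexp : ∀ s, 1 ≤ Real.exp (2 * ε * μ.real (Ioc 0 s)) := fun s =>
    Real.one_le_exp (mul_nonneg (by positivity) measureReal_nonneg)
  have step : ∀ K, 0 ≤ K → (∀ s ≤ T, u s ≤ K * Real.exp (2 * ε * μ.real (Ioc 0 s))) →
      ∀ s ≤ T, u s ≤ (C + K / 2) * Real.exp (2 * ε * μ.real (Ioc 0 s)) := by
    intro K hK hKu t ht
    have h1 := (hu t ht).trans (add_le_add_right (key K hK hKu t ht) _)
    have h2 := hexp t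
    rw [← ENNReal.ofReal_add hC (mul_nonneg (by positivity) (by linarith)),
      ENNReal.ofReal_le_ofReal_iff (add_nonneg hC (mul_nonneg (by positivity) (by linarith)))] at h1
    nlinarith
  -- The best constant in the exponential bound. It is finite because `u` is bounded by `R`;
  -- self-improvement gives `K ≤ C + K / 2`, so `K ≤ 2 * C`.
  set K : ℝ := ⨆ s : Iic T, u s / Real.exp (2 * ε * μ.real (Ioc 0 (s : ℝ≥0))) with hKdef
  have hR0 : 0 ≤ R := (hu0 T).trans (hR T le_rfl)
  have hbdd : BddAbove (range fun s : Iic T => u s / Real.exp (2 * ε * μ.real (Ioc 0 (s : ℝ≥0)))) := by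
    refine ⟨R, ?_⟩
    rintro _ ⟨s, rfl⟩
    have h3 := hexp s
    rw [div_le_iff₀ (by positivity)]
    nlinarith [hR s s.2]
  have hKu : ∀ s ≤ T, u s ≤ K * Real.exp (2 * ε * μ.real (Ioc 0 s)) := fun s hs => by
    rw [← div_le_iff₀ (by positivity)]
    exact le_ciSup hbdd ⟨s, hs⟩
  have hK0 : 0 ≤ K := Real.iSup_nonneg fun s => div_nonneg (hu0 s) (Real.exp_pos _).le
  have hne : Nonempty (Iic T) := ⟨⟨T, mem_Iic.2 le_rfl⟩⟩
  have hK2 : K ≤ C + K / 2 := ciSup_le fun s => by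
    rw [div_le_iff₀ (by positivity)]
    exact step K hK0 hKu s s.2
  refine (key K hK0 hKu T le_rfl).trans (ENNReal.ofReal_le_ofReal ?_)
  have := hexp T
  exact mul_le_mul_of_nonneg_right (by linarith) (by linarith)

/-! ### Separability and diagonal operators -/

section Separability

variable {𝕜 H : Type*} [RCLike 𝕜] [NormedAddCommGroup H] [InnerProductSpace 𝕜 H]

lemma HilbertBasis.separableSpace (e : HilbertBasis ℕ 𝕜 H) : TopologicalSpace.SeparableSpace H := by
  have h1 : TopologicalSpace.IsSeparable (Submodule.span 𝕜 (range e) : Set H) :=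
    (countable_range e).isSeparable.span
  have h2 : Dense (Submodule.span 𝕜 (range e) : Set H) := by
    rw [Submodule.dense_iff_topologicalClosure_eq_top]
    exact e.dense_span
  have h3 := h1.closure
  rw [h2.closure_eq] at h3
  exact TopologicalSpace.isSeparable_univ_iff.1 h3

lemma HilbertBasis.separableSpace_lp (e : HilbertBasis ℕ 𝕜 H) :
    TopologicalSpace.SeparableSpace (lp (fun _ : ℕ => H) 2) := by
  have := e.separableSpace
  have h1 : TopologicalSpace.IsSeparable
      (⋃ i : ℕ, range fun x : H => (lp.single 2 i x : lp (fun _ : ℕ => H) 2)) :=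
    .iUnion fun i => TopologicalSpace.isSeparable_range
      (lp.singleContinuousAddMonoidHom (E := fun _ : ℕ => H) 2 i).continuous_toFun
  have h2 := (h1.span (R := 𝕜)).closure
  refine TopologicalSpace.isSeparable_univ_iff.1 (h2.mono fun f _ => ?_)
  refine mem_closure_of_tendsto (lp.hasSum_single (by simp) f) (Eventually.of_forall fun s => ?_)
  exact Submodule.sum_mem _ fun i _ => Submodule.subset_span (mem_iUnion.2 ⟨i, mem_range_self _⟩)

lemma HilbertBasis.inner_apply_of_diagonal (e : HilbertBasis ℕ 𝕜 H) {T : H →L[𝕜] H} {c : ℕ → 𝕜}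
    (hT : ∀ j, T (e j) = c j • e j) (k : ℕ) (x : H) :
    ⟪e k, T x⟫_𝕜 = c k * ⟪e k, x⟫_𝕜 := by
  have h : (innerSL 𝕜 (e k)).comp T = c k • innerSL 𝕜 (e k) := by
    refine ContinuousLinearMap.ext_on (s := range e) ?_ ?_
    · rw [Submodule.dense_iff_topologicalClosure_eq_top]
      exact e.dense_span
    · rintro _ ⟨j, rfl⟩
      simp only [ContinuousLinearMap.comp_apply, hT, map_smul, _root_.smul_apply,
        innerSL_apply_apply, smul_eq_mul]
      rcases eq_or_ne k j with rfl | hkj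
      · rfl
      · rw [e.orthonormal.2 hkj, mul_zero, mul_zero]
  simpa using congrArg (fun f : H →L[𝕜] 𝕜 => f x) h

end Separability

namespace HilbertSchmidt

variable {𝕜 H : Type*} [RCLike 𝕜] [NormedAddCommGroup H] [InnerProductSpace 𝕜 H]
  {e : HilbertBasis ℕ 𝕜 H}

/-- The Hilbert–Schmidt norm is induced from the separable space `ℓ²(ℕ, H)`. Second countability
makes the support of `ν` conull, so that almost every jump is diagonal. -/
lemma secondCountableTopology (e : HilbertBasis ℕ 𝕜 H) :
    SecondCountableTopology (HilbertSchmidt e) := by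
  have := e.separableSpace_lp
  have := UniformSpace.secondCountable_of_separable (lp (fun _ : ℕ => H) 2)
  have h : Topology.IsInducing (toLp e) := ⟨rfl⟩
  exact h.secondCountableTopology

lemma norm_apply_basis_le (z : HilbertSchmidt e) (j : ℕ) : ‖z.toCLM (e j)‖ ≤ ‖z‖ :=
  lp.norm_apply_le_norm (by simp) (toLp e z) j

lemma continuous_apply_basis (j : ℕ) : Continuous fun z : HilbertSchmidt e => z.toCLM (e j) := by
  refine LipschitzWith.continuous (K := 1) (LipschitzWith.of_dist_le_mul fun y z => ?_)
  rw [dist_eq_norm, dist_eq_norm, NNReal.coe_one, one_mul]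
  exact norm_apply_basis_le (y - z) j

/-- The `k`-th diagonal entry of an operator. -/
noncomputable def diagEntry (k : ℕ) (z : HilbertSchmidt e) : 𝕜 := ⟪e k, z.toCLM (e k)⟫_𝕜

lemma continuous_diagEntry (k : ℕ) : Continuous (diagEntry k : HilbertSchmidt e → 𝕜) :=
  continuous_const.inner (continuous_apply_basis k)

lemma norm_diagEntry_le (k : ℕ) (z : HilbertSchmidt e) : ‖diagEntry k z‖ ≤ ‖z‖ := by
  refine (norm_inner_le_norm _ _).trans ?_
  rw [e.orthonormal.1 k, one_mul]
  exact norm_apply_basis_le z k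

lemma IsDiagonal.apply_basis {z : HilbertSchmidt e} (hz : z.IsDiagonal) (j : ℕ) :
    z.toCLM (e j) = diagEntry j z • e j := by
  obtain ⟨c, hc⟩ := hz j
  rw [diagEntry, hc, inner_smul_right, inner_self_eq_norm_sq_to_K, e.orthonormal.1 j]
  simp

lemma IsDiagonal.inner_apply {z : HilbertSchmidt e} (hz : z.IsDiagonal) (k : ℕ) (x : H) :
    ⟪e k, z.toCLM x⟫_𝕜 = diagEntry k z * ⟪e k, x⟫_𝕜 :=
  e.inner_apply_of_diagonal hz.apply_basis k x

lemma isDiagonal_iff {z : HilbertSchmidt e} :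
    z.IsDiagonal ↔ ∀ j, z.toCLM (e j) = diagEntry j z • e j :=
  ⟨fun h => h.apply_basis, fun h j => ⟨_, h j⟩⟩

lemma isClosed_isDiagonal : IsClosed {z : HilbertSchmidt e | z.IsDiagonal} := by
  simp only [isDiagonal_iff, ofPred_forall]
  exact isClosed_iInter fun j => isClosed_eq (continuous_apply_basis j)
    ((continuous_diagEntry j).smul continuous_const)

lemma measurableSet_annulus (η : ℝ) : MeasurableSet (annulus e η) :=
  (measurableSet_le measurable_const measurable_norm).inter
    (measurableSet_lt measurable_norm measurable_const)

end HilbertSchmidt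

/-! ### Lévy measures -/

section Levy

/-- The density `min 1 (‖z‖ ^ 2)` turns `ν` into a finite measure, and it is nonzero away from the
null set `{0}`, so dividing by it recovers `ν`. -/
lemma IsLevyMeasure.sFinite {E : Type*} [NormedAddCommGroup E] [MeasurableSpace E] [BorelSpace E]
    {ν : Measure E} (hν : IsLevyMeasure ν) : SFinite ν := by
  have hmeas : Measurable fun z : E => min (1 : ℝ≥0∞) (‖z‖ₑ ^ 2) := by fun_prop
  have hfin : IsFiniteMeasure (ν.withDensity fun z => min 1 (‖z‖ₑ ^ 2)) :=
    isFiniteMeasure_withDensity hν.integral_lt_top.ne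
  have h := withDensity_inv_same (μ := ν) hmeas ?_ ?_
  · rw [← h]
    infer_instance
  · have h0 : ∀ᵐ z ∂ν, z ≠ 0 := by
      rw [ae_iff]
      simpa using hν.zero
    filter_upwards [h0] with z hz
    simp [hz]
  · exact ae_of_all _ fun z => ne_top_of_le_ne_top ENNReal.one_ne_top (min_le_left _ _)

lemma IsLevyMeasure.measure_annulus_ne_top {𝕜 H : Type*} [RCLike 𝕜] [NormedAddCommGroup H]
    [InnerProductSpace 𝕜 H] {e : HilbertBasis ℕ 𝕜 H} {ν : Measure (HilbertSchmidt e)}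
    (hν : IsLevyMeasure ν) {η : ℝ} (hη : 0 < η) : ν (HilbertSchmidt.annulus e η) ≠ ∞ := by
  have hmeas : Measurable fun z : HilbertSchmidt e => min (1 : ℝ≥0∞) (‖z‖ₑ ^ 2) := by fun_prop
  have hc0 : min (1 : ℝ≥0∞) (ENNReal.ofReal η ^ 2) ≠ 0 := by
    simp [hη]
  -- Markov's inequality: the Lévy integrand is at least `min 1 (η ^ 2)` on the annulus.
  refine ne_top_of_le_ne_top ?_ ((measure_mono ?_).trans
    (meas_ge_le_lintegral_div (μ := ν) hmeas.aemeasurable hc0 ?_))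
  · exact ENNReal.div_ne_top hν.integral_lt_top.ne hc0
  · intro z hz
    change min (1 : ℝ≥0∞) (ENNReal.ofReal η ^ 2) ≤ min 1 (‖z‖ₑ ^ 2)
    refine min_le_min le_rfl ?_
    gcongr
    rw [← ofReal_norm]
    exact ENNReal.ofReal_le_ofReal hz.1
  · exact ne_top_of_le_ne_top ENNReal.one_ne_top (min_le_left _ _)

end Levy

/-! ### Poisson random measures -/

lemma timeMeasure_Ioc (t : ℝ≥0) : timeMeasure (Ioc 0 t) = t := by
  have hemb : MeasurableEmbedding (fun t : ℝ≥0 => (t : ℝ)) :=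
    MeasurableEmbedding.subtype_coe measurableSet_Ici
  rw [timeMeasure, hemb.comap_apply]
  have : (fun t : ℝ≥0 => (t : ℝ)) '' Ioc 0 t = Ioc (0 : ℝ) t := by
    ext x
    constructor
    · rintro ⟨y, hy, rfl⟩
      exact ⟨NNReal.coe_pos.2 hy.1, NNReal.coe_le_coe.2 hy.2⟩
    · intro hx
      exact ⟨⟨x, hx.1.le⟩, ⟨hx.1, hx.2⟩, rfl⟩
  rw [this]
  simp

instance : SFinite timeMeasure := by
  have : SigmaFinite timeMeasure := by
    refine ⟨⟨⟨fun n : ℕ => Iic (n : ℝ≥0), fun _ => trivial, fun n => ?_, ?_⟩⟩⟩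
    · have hemb : MeasurableEmbedding (fun t : ℝ≥0 => (t : ℝ)) :=
        MeasurableEmbedding.subtype_coe measurableSet_Ici
      rw [timeMeasure, hemb.comap_apply]
      refine (measure_mono (t := Icc (0 : ℝ) n) ?_).trans_lt (by simp)
      rintro _ ⟨y, hy, rfl⟩
      exact ⟨y.2, by exact_mod_cast mem_Iic.1 hy⟩
    · refine eq_univ_of_forall fun x => mem_iUnion.2 ?_
      exact (exists_nat_ge x).imp fun n hn => hn
  infer_instance

lemma lintegral_exp_mul_poissonMeasure (r : ℝ≥0) (b : ℝ) :
    ∫⁻ n : ℕ, ENNReal.ofReal (Real.exp (b * n)) ∂(poissonMeasure r) =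
      ENNReal.ofReal (Real.exp (r * (Real.exp b - 1))) := by
  rw [lintegral_countable']
  simp_rw [poissonMeasure_singleton]
  have h : HasSum (fun n : ℕ => Real.exp (b * n) * (Real.exp (-r) * r ^ n / n.factorial))
      (Real.exp (r * (Real.exp b - 1))) := by
    have h1 := (NormedSpace.expSeries_div_hasSum_exp (r * Real.exp b : ℝ)).mul_left (Real.exp (-r))
    rw [← Real.exp_eq_exp_ℝ, ← Real.exp_add] at h1
    convert! h1 using 1
    · ext n
      rw [mul_pow, ← Real.exp_nat_mul, mul_comm b]
      ring
    · congr 1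
      ring
  rw [← h.tsum_eq, ENNReal.ofReal_tsum_of_nonneg (fun n => by positivity) h.summable]
  refine tsum_congr fun n => ?_
  rw [ENNReal.ofReal_mul (Real.exp_pos _).le]

namespace IsPoissonRandomMeasure

variable {Ω E : Type*} [MeasurableSpace Ω] [MeasurableSpace E] {P : Measure Ω}
  {𝓕 : Filtration ℝ≥0 ‹MeasurableSpace Ω›} {ν : Measure E} {N : Ω → Measure (ℝ≥0 × E)}

lemma lintegral_comp (hN : IsPoissonRandomMeasure P 𝓕 ν N) {B : Set (ℝ≥0 × E)}
    (hB : MeasurableSet B) (hfin : (timeMeasure.prod ν) B ≠ ∞) {f : ℝ≥0∞ → ℝ≥0∞}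
    (hf : Measurable f) :
    ∫⁻ ω, f (N ω B) ∂P = ∫⁻ n : ℕ, f n ∂(poissonMeasure ((timeMeasure.prod ν) B).toNNReal) := by
  rw [← lintegral_map hf (hN.measurable B hB), hN.poisson B hB hfin,
    lintegral_map hf .of_discrete]

lemma ae_lt_top (hN : IsPoissonRandomMeasure P 𝓕 ν N) {B : Set (ℝ≥0 × E)}
    (hB : MeasurableSet B) (hfin : (timeMeasure.prod ν) B ≠ ∞) : ∀ᵐ ω ∂P, N ω B < ∞ := by
  have h : ∀ᵐ x ∂(P.map fun ω => N ω B), x < ∞ := by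
    rw [hN.poisson B hB hfin, ae_map_iff Measurable.of_discrete.aemeasurable measurableSet_Iio]
    exact ae_of_all _ fun n => by simp
  exact ae_of_ae_map (hN.measurable B hB).aemeasurable h

lemma ae_eq_zero (hN : IsPoissonRandomMeasure P 𝓕 ν N) {B : Set (ℝ≥0 × E)}
    (hB : MeasurableSet B) (h0 : (timeMeasure.prod ν) B = 0) : ∀ᵐ ω ∂P, N ω B = 0 := by
  have h := hN.lintegral_comp hB (by simp [h0]) measurable_id
  rw [h0, lintegral_countable' (α := ℕ)] at h
  simp_rw [poissonMeasure_singleton] at h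
  have h2 : ∫⁻ ω, N ω B ∂P = 0 := by
    refine h.trans (ENNReal.tsum_eq_zero.2 fun n => ?_)
    rcases n with _ | n <;> simp
  exact (lintegral_eq_zero_iff (hN.measurable B hB)).1 h2

lemma lintegral_exp_mul (hN : IsPoissonRandomMeasure P 𝓕 ν N) {B : Set (ℝ≥0 × E)}
    (hB : MeasurableSet B) (hfin : (timeMeasure.prod ν) B ≠ ∞) (b : ℝ) :
    ∫⁻ ω, ENNReal.ofReal (Real.exp (b * (N ω B).toReal)) ∂P =
      ENNReal.ofReal (Real.exp (((timeMeasure.prod ν) B).toReal * (Real.exp b - 1))) := by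
  rw [hN.lintegral_comp hB hfin (f := fun x => ENNReal.ofReal (Real.exp (b * x.toReal)))
    (by fun_prop)]
  exact lintegral_exp_mul_poissonMeasure _ b

end IsPoissonRandomMeasure

/-! ### The Wasserstein distance to a Dirac measure -/

/-- Under any coupling with a Dirac mass the second component is almost surely `0`, so all couplings
have the same cost. -/
lemma wassersteinDist_two_dirac_zero {G : Type*} [NormedAddCommGroup G] [MeasurableSpace G]
    [BorelSpace G] (μ : Measure G) [IsProbabilityMeasure μ] :
    wassersteinDist 2 μ (Measure.dirac 0) = (∫⁻ x, ‖x‖ₑ ^ (2 : ℝ) ∂μ) ^ (1 / 2 : ℝ) := by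
  have key : ∀ π : Measure (G × G), π.map Prod.fst = μ ∧ π.map Prod.snd = Measure.dirac 0 →
      ∫⁻ q, ‖q.1 - q.2‖ₑ ^ (2 : ℝ) ∂π = ∫⁻ x, ‖x‖ₑ ^ (2 : ℝ) ∂μ := by
    rintro π ⟨h1, h2⟩
    have h3 : ∀ᵐ x ∂(π.map Prod.snd), x = (0 : G) := by
      rw [h2]
      exact (ae_dirac_iff (measurableSet_singleton (0 : G))).2 rfl
    have h4 : ∀ᵐ q ∂π, q.2 = 0 := ae_of_ae_map measurable_snd.aemeasurable h3
    rw [← h1, lintegral_map (by fun_prop) measurable_fst]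
    refine lintegral_congr_ae ?_
    filter_upwards [h4] with q hq
    rw [hq, sub_zero]
  have hmin : min (1 : ℝ) (1 / 2) = 1 / 2 := by norm_num
  rw [wassersteinDist, hmin]
  refine le_antisymm ?_ (le_iInf₂ fun π hπ => by rw [key π hπ])
  have hm : Measurable fun x : G => (x, (0 : G)) := by fun_prop
  have hπ : (μ.map fun x => (x, (0 : G))).map Prod.fst = μ ∧
      (μ.map fun x => (x, (0 : G))).map Prod.snd = Measure.dirac 0 := by
    rw [Measure.map_map measurable_fst hm, Measure.map_map measurable_snd hm]
    constructor
    · exact Measure.map_id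
    · change μ.map (fun _ => (0 : G)) = _
      simp [Measure.map_const]
  exact iInf₂_le_of_le _ hπ (by rw [key _ hπ])

/-! ### Coordinates with respect to the basis -/

section Coordinates

variable {𝕜 H : Type*} [RCLike 𝕜] [NormedAddCommGroup H] [InnerProductSpace 𝕜 H]

lemma HilbertBasis.hasSum_norm_sq_inner (e : HilbertBasis ℕ 𝕜 H) (x : H) :
    HasSum (fun k => ‖⟪e k, x⟫_𝕜‖ ^ 2) (‖x‖ ^ 2) := by
  have h := lp.hasSum_norm (p := 2) (by norm_num) (e.repr x)
  simp only [ENNReal.toReal_ofNat, Real.rpow_ofNat, LinearIsometryEquiv.norm_map,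
    e.repr_apply_apply] at h
  exact h

lemma HilbertBasis.norm_le_mul_of_inner (e : HilbertBasis ℕ 𝕜 H) {x y : H} {c : ℝ} (hc : 0 ≤ c)
    (h : ∀ k, ‖⟪e k, x⟫_𝕜‖ ≤ c * ‖⟪e k, y⟫_𝕜‖) : ‖x‖ ≤ c * ‖y‖ := by
  refine le_of_sq_le_sq ?_ (by positivity)
  rw [mul_pow]
  refine hasSum_le (fun k => ?_) (e.hasSum_norm_sq_inner x)
    ((e.hasSum_norm_sq_inner y).mul_left (c ^ 2))
  rw [← mul_pow]
  gcongr
  exact h k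

/-- The two scalar actions agree because the continuous additive map `c ↦ c • x` from `𝕜` to `H` is
automatically real-linear. -/
lemma ofReal_smul_eq_smul [NormedSpace ℝ H] (r : ℝ) (x : H) : (r : 𝕜) • x = r • x := by
  have h := map_real_smul (AddMonoidHom.mk' (fun c : 𝕜 => c • x) fun a b => add_smul a b x)
    (continuous_id.smul continuous_const) r (1 : 𝕜)
  have h' : (r • (1 : 𝕜)) • x = r • ((1 : 𝕜) • x) := h
  rwa [RCLike.real_smul_eq_coe_mul, mul_one, one_smul] at h'

lemma inner_real_smul [NormedSpace ℝ H] (r : ℝ) (x y : H) :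
    ⟪x, r • y⟫_𝕜 = (r : 𝕜) * ⟪x, y⟫_𝕜 := by
  rw [← ofReal_smul_eq_smul (𝕜 := 𝕜), inner_smul_right]

end Coordinates

/-! ### The leading vector -/

section LeadingVector

variable {𝕜 H : Type*} [RCLike 𝕜] [NormedAddCommGroup H] [InnerProductSpace 𝕜 H]

lemma HilbertBasis.inner_leadingIndex_ne_zero (e : HilbertBasis ℕ 𝕜 H) {h : H} (h0 : h ≠ 0) : ⟪e (leadingIndex e h), h⟫_𝕜 ≠ 0 := by
  have hne : {k | ⟪e k, h⟫_𝕜 ≠ 0}.Nonempty := by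
    by_contra hemp
    rw [not_nonempty_iff_eq_empty, eq_empty_iff_forall_notMem] at hemp
    have h1 := e.hasSum_norm_sq_inner h
    have h2 : (fun k => ‖⟪e k, h⟫_𝕜‖ ^ 2) = fun _ => 0 := by
      ext k
      have : ⟪e k, h⟫_𝕜 = 0 := not_not.1 (hemp k)
      simp [this]
    rw [h2] at h1
    exact h0 (by simpa using h1.unique hasSum_zero)
  exact Nat.sInf_mem hne

variable [CompleteSpace H] {A : H →ₗ.[𝕜] H} {e : HilbertBasis ℕ 𝕜 H} {lam : ℕ → ℝ}

lemma IsNegativeWithEigenbasis.pos' (hA : IsNegativeWithEigenbasis A e lam) (k : ℕ) : 0 < lam k :=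
  hA.pos.trans_le (hA.mono (Nat.zero_le k))

lemma IsNegativeWithEigenbasis.finite_leadingSet (hA : IsNegativeWithEigenbasis A e lam) (h : H) :
    (leadingSet e lam h).Finite := by
  obtain ⟨n, hn⟩ := (hA.tendsto.eventually_gt_atTop (lam (leadingIndex e h))).exists_forall_of_atTop
  refine (finite_Iio n).subset fun k hk => ?_
  by_contra hkn
  exact (hn k (not_lt.1 hkn)).ne' hk.2

open Classical in
lemma IsNegativeWithEigenbasis.inner_leadingVector (hA : IsNegativeWithEigenbasis A e lam)
    (h : H) (j : ℕ) :
    ⟪e j, leadingVector e lam h⟫_𝕜 = if j ∈ leadingSet e lam h then ⟪e j, h⟫_𝕜 else 0 := by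
  have hfin := hA.finite_leadingSet h
  have hv : leadingVector e lam h = ∑ k ∈ hfin.toFinset, ⟪e k, h⟫_𝕜 • e k := by
    rw [leadingVector, tsum_subtype (leadingSet e lam h) fun k => ⟪e k, h⟫_𝕜 • e k,
      tsum_eq_sum (s := hfin.toFinset)]
    · refine Finset.sum_congr rfl fun k hk => indicator_of_mem (hfin.mem_toFinset.1 hk) _
    · intro k hk
      exact indicator_of_notMem (fun h' => hk (hfin.mem_toFinset.2 h')) _
  rw [hv, inner_sum]
  simp only [inner_smul_right, orthonormal_iff_ite.1 e.orthonormal, mul_ite, mul_one, mul_zero,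
    Finset.sum_ite_eq, hfin.mem_toFinset]

lemma IsNegativeWithEigenbasis.leadingVector_ne_zero (hA : IsNegativeWithEigenbasis A e lam)
    {h : H} (h0 : h ≠ 0) : leadingVector e lam h ≠ 0 := by
  intro hv
  have h1 := hA.inner_leadingVector h (leadingIndex e h)
  rw [hv, inner_zero_right, if_pos ⟨e.inner_leadingIndex_ne_zero h0, rfl⟩] at h1
  exact e.inner_leadingIndex_ne_zero h0 h1.symm

end LeadingVector

/-! ### The semigroup -/

section SemigroupLemmas

variable {𝕜 H : Type*} [RCLike 𝕜] [NormedAddCommGroup H] [InnerProductSpace 𝕜 H]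
  [NormedSpace ℝ H] {A : H →ₗ.[𝕜] H} {S : ℝ≥0 → H →L[𝕜] H}

/-- By the semigroup law the difference quotient at `s` is `S s` applied to the one at `0`. Only the
right derivative comes out, and it suffices to show that continuous functions are constant. -/
lemma IsC0SemigroupGeneratedBy.hasDerivWithinAt (hS : IsC0SemigroupGeneratedBy S A) {x y : H}
    (hxy : (x, y) ∈ A.graph) {s : ℝ} (hs : 0 ≤ s) :
    HasDerivWithinAt (fun s : ℝ => S s.toNNReal x) (S s.toNNReal y) (Ici s) s := by
  rw [← hasDerivWithinAt_Ioi_iff_Ici, hasDerivWithinAt_iff_tendsto_slope' self_notMem_Ioi]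
  have h1 := (hS.generator x y).1 hxy
  have h2 : Tendsto (fun r : ℝ => (r - s).toNNReal) (𝓝[>] s) (𝓝[>] 0) := by
    refine tendsto_nhdsWithin_iff.2 ⟨?_, ?_⟩
    · have : Continuous fun r : ℝ => (r - s).toNNReal := by fun_prop
      have h3 := this.tendsto s
      rw [sub_self, Real.toNNReal_zero] at h3
      exact h3.mono_left nhdsWithin_le_nhds
    · filter_upwards [self_mem_nhdsWithin] with r hr
      exact Real.toNNReal_pos.2 (sub_pos.2 hr)
  refine (((S s.toNNReal).continuous.tendsto y).comp (h1.comp h2)).congr' ?_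
  filter_upwards [self_mem_nhdsWithin] with r hr
  have hr' : s < r := hr
  simp only [Function.comp_apply, slope_def_module]
  rw [map_real_smul (S s.toNNReal) (S s.toNNReal).continuous,
    Real.coe_toNNReal _ (sub_nonneg.2 hr'.le), map_sub, ← ContinuousLinearMap.comp_apply, ← hS.add,
    ← Real.toNNReal_add hs (sub_nonneg.2 hr'.le), add_sub_cancel]

variable [CompleteSpace H] {e : HilbertBasis ℕ 𝕜 H} {lam : ℕ → ℝ}

lemma IsC0SemigroupGeneratedBy.apply_basis (hS : IsC0SemigroupGeneratedBy S A)
    (hA : IsNegativeWithEigenbasis A e lam) (t : ℝ≥0) (n : ℕ) :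
    S t (e n) = ((Real.exp (-lam n * t) : ℝ) : 𝕜) • e n := by
  have hgraph : (e n, -(lam n : 𝕜) • e n) ∈ A.graph := by
    rw [LinearPMap.mem_graph_iff]
    exact ⟨⟨e n, hA.mem_domain n⟩, rfl, hA.eigenvector n⟩
  have hcont : Continuous fun s : ℝ => Real.exp (lam n * s) • S s.toNNReal (e n) := by
    have := (hS.continuous (e n)).comp continuous_real_toNNReal
    exact (by fun_prop : Continuous fun s : ℝ => Real.exp (lam n * s)).smul this
  have hconst := constant_of_has_deriv_right_zero (a := 0) (b := (t : ℝ)) hcont.continuousOn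
    -- `exp (λ_n s) • S s (e n)` is continuous with zero right derivative, hence equal to its
    -- initial value `e n`.
    (fun s hs => ?_) t ⟨t.2, le_rfl⟩
  · simp only [Real.toNNReal_coe, mul_zero, Real.exp_zero, one_smul, Real.toNNReal_zero, hS.zero,
      ContinuousLinearMap.id_apply] at hconst
    have h1 := congrArg (fun x => Real.exp (-lam n * t) • x) hconst
    simp only [smul_smul, ← Real.exp_add] at h1
    rw [ofReal_smul_eq_smul, ← h1]
    simp
  · have h1 := hS.hasDerivWithinAt hgraph hs.1
    have h2 : HasDerivAt (fun s => Real.exp (lam n * s)) (Real.exp (lam n * s) * (lam n * 1)) s :=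
      ((hasDerivAt_id s).const_mul (lam n)).exp
    convert! h2.hasDerivWithinAt.smul h1 using 1
    rw [map_smul, ← RCLike.ofReal_neg, ofReal_smul_eq_smul]
    module

lemma IsC0SemigroupGeneratedBy.inner_apply (hS : IsC0SemigroupGeneratedBy S A)
    (hA : IsNegativeWithEigenbasis A e lam) (t : ℝ≥0) (k : ℕ) (x : H) :
    ⟪e k, S t x⟫_𝕜 = (Real.exp (-lam k * t) : ℝ) * ⟪e k, x⟫_𝕜 :=
  e.inner_apply_of_diagonal (hS.apply_basis hA t) k x

lemma IsC0SemigroupGeneratedBy.norm_apply_le (hS : IsC0SemigroupGeneratedBy S A)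
    (hA : IsNegativeWithEigenbasis A e lam) (t : ℝ≥0) (x : H) : ‖S t x‖ ≤ ‖x‖ := by
  rw [← one_mul ‖x‖]
  refine e.norm_le_mul_of_inner zero_le_one fun k => ?_
  rw [hS.inner_apply hA, norm_mul, RCLike.norm_ofReal, abs_of_pos (Real.exp_pos _)]
  gcongr
  rw [Real.exp_le_one_iff]
  have := mul_nonneg (hA.pos' k).le t.coe_nonneg
  linarith

lemma IsC0SemigroupGeneratedBy.tendsto_leadingVector (hS : IsC0SemigroupGeneratedBy S A)
    (hA : IsNegativeWithEigenbasis A e lam) (h : H) :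
    Tendsto (fun t : ℝ≥0 => Real.exp (t * lam (leadingIndex e h)) • S t h) atTop
      (𝓝 (leadingVector e lam h)) := by
  classical
  set L := lam (leadingIndex e h) with hL
  set v := leadingVector e lam h with hv
  have hcoord : ∀ (t : ℝ≥0) k, ‖⟪e k, Real.exp (t * L) • S t h - v⟫_𝕜‖ ^ 2 =
      if k ∈ leadingSet e lam h then 0
        else (Real.exp (-((lam k - L) * t)) * ‖⟪e k, h⟫_𝕜‖) ^ 2 := by
    intro t k
    have h1 : ⟪e k, Real.exp (t * L) • S t h⟫_𝕜 =
        ((Real.exp (-((lam k - L) * t)) : ℝ) : 𝕜) * ⟪e k, h⟫_𝕜 := by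
      rw [inner_real_smul, hS.inner_apply hA, ← mul_assoc, ← RCLike.ofReal_mul, ← Real.exp_add]
      congr 3
      ring
    rw [inner_sub_right, h1, hA.inner_leadingVector]
    split_ifs with hk
    · rw [hk.2]
      simp [hL]
    · rw [sub_zero, norm_mul, RCLike.norm_ofReal, abs_of_pos (Real.exp_pos _)]
  -- Off the leading set, a nonzero coordinate belongs to a strictly larger eigenvalue. Its rescaled
  -- value therefore decays and is dominated by `‖⟪e k, h⟫‖`, whose squares are summable.
  have hgt : ∀ k ∉ leadingSet e lam h, ⟪e k, h⟫_𝕜 ≠ 0 → L < lam k := fun k hk hk0 =>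
    lt_of_le_of_ne (hA.mono (Nat.sInf_le hk0)) fun heq => hk ⟨hk0, heq.symm⟩
  have hlim : Tendsto (fun t : ℝ≥0 => ∑' k, ‖⟪e k, Real.exp (t * L) • S t h - v⟫_𝕜‖ ^ 2) atTop
      (𝓝 (∑' _ : ℕ, 0)) := by
    refine tendsto_tsum_of_dominated_convergence (e.hasSum_norm_sq_inner h).summable
      (fun k => ?_) (Eventually.of_forall fun t k => ?_)
    · simp_rw [hcoord]
      split_ifs with hk
      · exact tendsto_const_nhds
      · by_cases hk0 : ⟪e k, h⟫_𝕜 = 0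
        · simp [hk0]
        · have h1 : Tendsto (fun t : ℝ≥0 => (lam k - L) * (t : ℝ)) atTop atTop :=
            (NNReal.tendsto_coe_atTop.2 tendsto_id).const_mul_atTop (sub_pos.2 (hgt k hk hk0))
          have h2 := (((Real.tendsto_exp_neg_atTop_nhds_zero.comp h1).mul_const
            ‖⟪e k, h⟫_𝕜‖).pow 2)
          simpa using h2
    · rw [hcoord, Real.norm_of_nonneg (by positivity)]
      split_ifs with hk
      · positivity
      · by_cases hk0 : ⟪e k, h⟫_𝕜 = 0
        · simp [hk0]
        · gcongr
          refine mul_le_of_le_one_left (norm_nonneg _) ?_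
          rw [Real.exp_le_one_iff]
          have := mul_nonneg (sub_pos.2 (hgt k hk hk0)).le t.coe_nonneg
          linarith
  simp_rw [(e.hasSum_norm_sq_inner _).tsum_eq, tsum_zero] at hlim
  rw [tendsto_iff_norm_sub_tendsto_zero]
  have h2 := hlim.sqrt
  simpa using h2

end SemigroupLemmas

/-! ### Càdlàg paths -/

namespace IsCadlagPath

variable {G : Type*}

lemma tendsto_leftLim [TopologicalSpace G] {f : ℝ≥0 → G} (hf : IsCadlagPath f) (t : ℝ≥0) :
    Tendsto f (𝓝[<] t) (𝓝 (Function.leftLim f t)) :=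
  tendsto_leftLim_of_tendsto (hf t).2

lemma exists_norm_le [NormedAddCommGroup G] {f : ℝ≥0 → G} (hf : IsCadlagPath f) (T : ℝ≥0) :
    ∃ R, 0 ≤ R ∧ ∀ s ≤ T, ‖f s‖ ≤ R := by
  have h : ∃ R, ∀ s ∈ Icc 0 T, ‖f s‖ ≤ R := by
    refine isCompact_Icc.induction_on (p := fun U => ∃ R, ∀ s ∈ U, ‖f s‖ ≤ R) ⟨0, by simp⟩
      (fun U V hUV ⟨R, hR⟩ => ⟨R, fun s hs => hR s (hUV hs)⟩)
      (fun U V ⟨R, hR⟩ ⟨R', hR'⟩ => ⟨max R R', ?_⟩) fun t _ => ?_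
    · rintro s (hs | hs)
      · exact (hR s hs).trans (le_max_left _ _)
      · exact (hR' s hs).trans (le_max_right _ _)
    · have h1 := ((hf t).1.norm).eventually_lt_const (lt_add_one ‖f t‖)
      have h2 := ((hf.tendsto_leftLim t).norm).eventually_lt_const
        (lt_add_one ‖Function.leftLim f t‖)
      have h3 : ∀ᶠ s in 𝓝 t, ‖f s‖ ≤ max (‖f t‖ + 1) (‖Function.leftLim f t‖ + 1) := by
        rw [← nhdsLT_sup_nhdsGE]
        exact eventually_sup.2 ⟨h2.mono fun s hs => hs.le.trans (le_max_right _ _),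
          h1.mono fun s hs => hs.le.trans (le_max_left _ _)⟩
      exact ⟨_, mem_nhdsWithin_of_mem_nhds h3, _, fun s hs => hs⟩
  obtain ⟨R, hR⟩ := h
  exact ⟨R, (norm_nonneg _).trans (hR 0 ⟨le_rfl, zero_le⟩), fun s hs => hR s ⟨zero_le, hs⟩⟩

lemma norm_leftLim_le [NormedAddCommGroup G] {f : ℝ≥0 → G} (hf : IsCadlagPath f) {T : ℝ≥0} {R : ℝ}
    (hR : ∀ s ≤ T, ‖f s‖ ≤ R) {s : ℝ≥0} (hs : s ∈ Ioc 0 T) : ‖Function.leftLim f s‖ ≤ R := by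
  have : (𝓝[<] s).NeBot := nhdsLT_neBot_of_exists_lt ⟨0, hs.1⟩
  refine le_of_tendsto (hf.tendsto_leftLim s).norm ?_
  filter_upwards [self_mem_nhdsWithin] with r hr
  exact hR r ((mem_Iio.1 hr).le.trans hs.2)

lemma stronglyMeasurable_leftLim [TopologicalSpace G] [TopologicalSpace.PseudoMetrizableSpace G]
    [T2Space G] {f : ℝ≥0 → G} (hf : IsCadlagPath f) :
    StronglyMeasurable (Function.leftLim f) := by
  -- Approximation from strictly below: the largest multiple of `1 / (n + 1)` that is less than `s`.
  -- At `s = 0` truncated subtraction returns `0`, in accordance with the convention `leftLim f 0 =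
  -- f 0`. Each approximant factors through `ℕ`, so it is strongly measurable for any `f`.
  have hlim : ∀ s : ℝ≥0, Tendsto (fun n : ℕ =>
      f (((⌈(n + 1 : ℝ≥0) * s⌉₊ - 1 : ℕ) : ℝ≥0) / (n + 1))) atTop (𝓝 (Function.leftLim f s)) := by
    intro s
    rcases eq_or_ne s 0 with rfl | hs
    · have h0 : Function.leftLim f 0 = f 0 := leftLim_eq_of_isBot isBot_bot
      simp [h0]
    · have hpos : 0 < s := pos_iff_ne_zero.2 hs
      have hcast : ∀ n : ℕ, ((⌈(n + 1 : ℝ≥0) * s⌉₊ - 1 : ℕ) : ℝ) = (⌈(n + 1 : ℝ≥0) * s⌉₊ : ℝ) - 1 := by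
        intro n
        rw [Nat.cast_sub (Nat.ceil_pos.2 (by positivity)), Nat.cast_one]
      have hle : ∀ n : ℕ, (n + 1 : ℝ) * s ≤ ⌈(n + 1 : ℝ≥0) * s⌉₊ := fun n => by
        exact_mod_cast NNReal.coe_le_coe.2 (Nat.le_ceil ((n + 1 : ℝ≥0) * s))
      have hlt : ∀ n : ℕ, (⌈(n + 1 : ℝ≥0) * s⌉₊ : ℝ) < (n + 1 : ℝ) * s + 1 := fun n => by
        exact_mod_cast NNReal.coe_lt_coe.2 (Nat.ceil_lt_add_one (zero_le (a := (n + 1 : ℝ≥0) * s)))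
      have hlt' : ∀ n : ℕ, ((⌈(n + 1 : ℝ≥0) * s⌉₊ - 1 : ℕ) : ℝ) / (n + 1) < s := fun n => by
        rw [div_lt_iff₀ (by positivity), hcast]
        linarith [hlt n]
      refine (hf.tendsto_leftLim s).comp (tendsto_nhdsWithin_iff.2 ⟨?_, ?_⟩)
      · rw [← NNReal.tendsto_coe]
        simp only [NNReal.coe_div, NNReal.coe_add, NNReal.coe_natCast, NNReal.coe_one]
        refine tendsto_of_tendsto_of_tendsto_of_le_of_le (g := fun n : ℕ => (s : ℝ) - 1 / (n + 1))
          ?_ tendsto_const_nhds (fun n => ?_) (fun n => (hlt' n).le)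
        · simpa using tendsto_const_nhds.sub (tendsto_one_div_add_atTop_nhds_zero_nat (𝕜 := ℝ))
        · change (s : ℝ) - 1 / (n + 1) ≤ ((⌈(n + 1 : ℝ≥0) * s⌉₊ - 1 : ℕ) : ℝ) / (n + 1)
          rw [hcast, sub_le_iff_le_add, ← add_div, le_div_iff₀ (by positivity)]
          linarith [hle n]
      · refine Eventually.of_forall fun n => NNReal.coe_lt_coe.1 ?_
        simp only [NNReal.coe_div, NNReal.coe_add, NNReal.coe_natCast, NNReal.coe_one]
        exact hlt' n
  refine stronglyMeasurable_of_tendsto atTop (f := fun (n : ℕ) s =>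
      f (((⌈(n + 1 : ℝ≥0) * s⌉₊ - 1 : ℕ) : ℝ≥0) / (n + 1))) (fun n => ?_) (tendsto_pi_nhds.2 hlim)
  have h1 : StronglyMeasurable fun m : ℕ => f (((m - 1 : ℕ) : ℝ≥0) / (n + 1)) :=
    .of_discrete
  exact h1.comp_measurable (Nat.measurable_ceil.comp (by fun_prop))

end IsCadlagPath

/-! ### The pathwise estimate -/

section Pathwise

variable {𝕜 H : Type*} [RCLike 𝕜] [NormedAddCommGroup H] [InnerProductSpace 𝕜 H]

lemma HilbertSchmidt.IsDiagonal.norm_apply_le {e : HilbertBasis ℕ 𝕜 H} {z : HilbertSchmidt e}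
    (hz : z.IsDiagonal) (x : H) : ‖z.toCLM x‖ ≤ ‖z‖ * ‖x‖ := by
  refine e.norm_le_mul_of_inner (norm_nonneg _) fun k => ?_
  rw [hz.inner_apply, norm_mul]
  gcongr
  exact norm_diagEntry_le k z

/-- The `k`-th coordinate as a real-linear functional. -/
noncomputable def realCoord [NormedSpace ℝ H] (e : HilbertBasis ℕ 𝕜 H) (k : ℕ) : H →L[ℝ] 𝕜 where
  toFun x := ⟪e k, x⟫_𝕜
  map_add' x y := inner_add_right _ x y
  map_smul' r x := by
    rw [inner_real_smul, RingHom.id_apply, RCLike.real_smul_eq_coe_mul]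
  cont := continuous_const.inner continuous_id

variable [NormedSpace ℝ H] [CompleteSpace H] {A : H →ₗ.[𝕜] H} {e : HilbertBasis ℕ 𝕜 H}
  {lam : ℕ → ℝ} {S : ℝ≥0 → H →L[𝕜] H}

lemma inner_convolution (hA : IsNegativeWithEigenbasis A e lam)
    (hS : IsC0SemigroupGeneratedBy S A) (x : H) {z : HilbertSchmidt e} (hz : z.IsDiagonal)
    (t s : ℝ≥0) (k : ℕ) :
    ⟪e k, S (t - s) (z.toCLM x)⟫_𝕜 =
      (Real.exp (-lam k * (t - s : ℝ≥0)) : ℝ) * (HilbertSchmidt.diagEntry k z * ⟪e k, x⟫_𝕜) := by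
  rw [hS.inner_apply hA, hz.inner_apply]

lemma aestronglyMeasurable_convolution (hA : IsNegativeWithEigenbasis A e lam)
    (hS : IsC0SemigroupGeneratedBy S A) {ρ : Measure (ℝ≥0 × HilbertSchmidt e)}
    (hdiag : ∀ᵐ p ∂ρ, p.2.IsDiagonal) {x : ℝ≥0 → H} (hx : IsCadlagPath x) (t : ℝ≥0) :
    AEStronglyMeasurable (fun p : ℝ≥0 × HilbertSchmidt e =>
      S (t - p.1) (p.2.toCLM (Function.leftLim x p.1))) ρ := by
  -- Joint measurability is checked on basis expansions: for diagonal operators each coordinate is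
  -- an explicit product of measurable scalar functions of time and of the operator.
  refine aestronglyMeasurable_of_tendsto_ae atTop (f := fun (n : ℕ) p => ∑ k ∈ Finset.range n,
    ⟪e k, S (t - p.1) (p.2.toCLM (Function.leftLim x p.1))⟫_𝕜 • e k) (fun n => ?_)
    (ae_of_all _ fun p => ?_)
  · refine Finset.aestronglyMeasurable_fun_sum _ fun k _ => ?_
    refine AEStronglyMeasurable.smul_const ?_ _
    have hk : StronglyMeasurable fun s => ⟪e k, Function.leftLim x s⟫_𝕜 :=
      (innerSL 𝕜 (e k)).continuous.comp_stronglyMeasurable hx.stronglyMeasurable_leftLim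
    have hm : Measurable fun p : ℝ≥0 × HilbertSchmidt e =>
        ((Real.exp (-lam k * (t - p.1 : ℝ≥0)) : ℝ) : 𝕜) *
          (HilbertSchmidt.diagEntry k p.2 * ⟪e k, Function.leftLim x p.1⟫_𝕜) := by
      refine Measurable.mul ?_ (Measurable.mul ?_ (hk.measurable.comp measurable_fst))
      · exact (by fun_prop : Continuous fun s : ℝ≥0 =>
          ((Real.exp (-lam k * (t - s : ℝ≥0)) : ℝ) : 𝕜)).measurable.comp measurable_fst
      · exact (HilbertSchmidt.continuous_diagEntry k).measurable.comp measurable_snd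
    refine hm.aestronglyMeasurable.congr ?_
    filter_upwards [hdiag] with p hp
    exact (inner_convolution hA hS _ hp t p.1 k).symm
  · have h := (e.hasSum_repr (S (t - p.1) (p.2.toCLM (Function.leftLim x p.1)))).tendsto_sum_nat
    simpa only [e.repr_apply_apply] using h

lemma integrableOn_convolution (hA : IsNegativeWithEigenbasis A e lam)
    (hS : IsC0SemigroupGeneratedBy S A) {ρ : Measure (ℝ≥0 × HilbertSchmidt e)}
    (hdiag : ∀ᵐ p ∂ρ, p.2.IsDiagonal) {x : ℝ≥0 → H} (hx : IsCadlagPath x) (t : ℝ≥0) {η : ℝ}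
    (hfin : ρ (Ioc 0 t ×ˢ HilbertSchmidt.annulus e η) ≠ ∞) :
    IntegrableOn (fun p : ℝ≥0 × HilbertSchmidt e =>
      S (t - p.1) (p.2.toCLM (Function.leftLim x p.1)))
      (Ioc 0 t ×ˢ HilbertSchmidt.annulus e η) ρ := by
  obtain ⟨R, hR0, hR⟩ := hx.exists_norm_le t
  refine Measure.integrableOn_of_bounded hfin (aestronglyMeasurable_convolution hA hS hdiag hx t)
    (M := R) ?_
  filter_upwards [ae_restrict_of_ae hdiag, ae_restrict_mem (measurableSet_Ioc.prod
    (HilbertSchmidt.measurableSet_annulus η))] with p hp hpB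
  refine (hS.norm_apply_le hA _ _).trans ((hp.norm_apply_le _).trans ?_)
  rw [← one_mul R]
  exact mul_le_mul hpB.2.2.le (hx.norm_leftLim_le hR hpB.1) (norm_nonneg _) zero_le_one

/-- The intensity in time of the jumps in the annulus, both actual and compensating. -/
noncomputable def jumpTimeMeasure (η : ℝ) (n Λ : Measure (ℝ≥0 × HilbertSchmidt e)) : Measure ℝ≥0 :=
  ((n + Λ).restrict (univ ×ˢ HilbertSchmidt.annulus e η)).map Prod.fst

omit [NormedSpace ℝ H] [CompleteSpace H] in
lemma setLIntegral_jumpTimeMeasure (η : ℝ) (n Λ : Measure (ℝ≥0 × HilbertSchmidt e)) (t : ℝ≥0)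
    {g : ℝ≥0 → ℝ≥0∞} (hg : Measurable g) :
    ∫⁻ s in Ioc 0 t, g s ∂(jumpTimeMeasure η n Λ) =
      ∫⁻ p in Ioc 0 t ×ˢ HilbertSchmidt.annulus e η, g p.1 ∂n +
        ∫⁻ p in Ioc 0 t ×ˢ HilbertSchmidt.annulus e η, g p.1 ∂Λ := by
  have hset : Prod.fst ⁻¹' Ioc 0 t ∩ univ ×ˢ HilbertSchmidt.annulus e η =
      Ioc 0 t ×ˢ HilbertSchmidt.annulus e η := by
    ext p
    simp
  rw [jumpTimeMeasure, setLIntegral_map measurableSet_Ioc hg measurable_fst,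
    Measure.restrict_restrict (measurable_fst measurableSet_Ioc), hset, Measure.restrict_add,
    lintegral_add_measure]

omit [NormedSpace ℝ H] [CompleteSpace H] in
lemma jumpTimeMeasure_Ioc (η : ℝ) (n Λ : Measure (ℝ≥0 × HilbertSchmidt e)) (t : ℝ≥0) :
    jumpTimeMeasure η n Λ (Ioc 0 t) = n (Ioc 0 t ×ˢ HilbertSchmidt.annulus e η) +
      Λ (Ioc 0 t ×ˢ HilbertSchmidt.annulus e η) := by
  simpa using setLIntegral_jumpTimeMeasure η n Λ t (g := 1) measurable_one

/-- The weights combine to `exp (λ_k t) exp (-λ_k (t - s)) = exp (λ_k s)`, the diagonal entry is at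
most `1` in modulus on the annulus, and the signed measure `n - Λ` is dominated by `n + Λ`. -/
lemma enorm_inner_compensatedIntegral_le (hA : IsNegativeWithEigenbasis A e lam)
    (hS : IsC0SemigroupGeneratedBy S A) {n Λ : Measure (ℝ≥0 × HilbertSchmidt e)}
    (hn : ∀ᵐ p ∂n, p.2.IsDiagonal) (hΛ : ∀ᵐ p ∂Λ, p.2.IsDiagonal)
    {x : ℝ≥0 → H} (hx : IsCadlagPath x) (t : ℝ≥0) {η : ℝ}
    (hnfin : n (Ioc 0 t ×ˢ HilbertSchmidt.annulus e η) ≠ ∞)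
    (hΛfin : Λ (Ioc 0 t ×ˢ HilbertSchmidt.annulus e η) ≠ ∞) (k : ℕ) :
    ENNReal.ofReal (Real.exp (lam k * t)) *
      ‖⟪e k, compensatedIntegral n Λ (Ioc 0 t ×ˢ HilbertSchmidt.annulus e η)
        (fun p => S (t - p.1) (p.2.toCLM (Function.leftLim x p.1)))⟫_𝕜‖ₑ ≤
      ∫⁻ s in Ioc 0 t, ENNReal.ofReal (Real.exp (lam k * s) * ‖⟪e k, Function.leftLim x s⟫_𝕜‖)
        ∂(jumpTimeMeasure η n Λ) := by
  have hk : StronglyMeasurable fun s => ⟪e k, Function.leftLim x s⟫_𝕜 :=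
    (innerSL 𝕜 (e k)).continuous.comp_stronglyMeasurable hx.stronglyMeasurable_leftLim
  have hmeas : Measurable fun s : ℝ≥0 =>
      ENNReal.ofReal (Real.exp (lam k * s) * ‖⟪e k, Function.leftLim x s⟫_𝕜‖) :=
    ((by fun_prop : Continuous fun s : ℝ≥0 => Real.exp (lam k * s)).measurable.mul
      hk.measurable.norm).ennreal_ofReal
  have key : ∀ ρ : Measure (ℝ≥0 × HilbertSchmidt e), (∀ᵐ p ∂ρ, p.2.IsDiagonal) →
      ρ (Ioc 0 t ×ˢ HilbertSchmidt.annulus e η) ≠ ∞ →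
      ENNReal.ofReal (Real.exp (lam k * t)) * ‖realCoord e k
        (∫ p in Ioc 0 t ×ˢ HilbertSchmidt.annulus e η,
          S (t - p.1) (p.2.toCLM (Function.leftLim x p.1)) ∂ρ)‖ₑ ≤
      ∫⁻ p in Ioc 0 t ×ˢ HilbertSchmidt.annulus e η,
        ENNReal.ofReal (Real.exp (lam k * p.1) * ‖⟪e k, Function.leftLim x p.1⟫_𝕜‖) ∂ρ := by
    intro ρ hρ hfin
    rw [← (realCoord e k).integral_comp_comm (integrableOn_convolution hA hS hρ hx t hfin)]
    refine (mul_le_mul' le_rfl (enorm_integral_le_lintegral_enorm _)).trans ?_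
    rw [← lintegral_const_mul' _ _ ENNReal.ofReal_ne_top]
    refine lintegral_mono_ae ?_
    filter_upwards [ae_restrict_of_ae hρ, ae_restrict_mem (measurableSet_Ioc.prod
      (HilbertSchmidt.measurableSet_annulus η))] with p hp hpB
    change _ * ‖⟪e k, _⟫_𝕜‖ₑ ≤ _
    rw [inner_convolution hA hS _ hp, ← ofReal_norm, ← ENNReal.ofReal_mul (Real.exp_pos _).le]
    refine ENNReal.ofReal_le_ofReal ?_
    rw [norm_mul, norm_mul, RCLike.norm_ofReal, abs_of_pos (Real.exp_pos _), ← mul_assoc,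
      ← Real.exp_add]
    have hexp : lam k * t + -lam k * (t - p.1 : ℝ≥0) = lam k * p.1 := by
      rw [NNReal.coe_sub hpB.1.2]
      ring
    rw [hexp]
    gcongr
    refine mul_le_of_le_one_left (norm_nonneg _) ?_
    exact (HilbertSchmidt.norm_diagEntry_le k p.2).trans hpB.2.2.le
  rw [setLIntegral_jumpTimeMeasure η n Λ t hmeas, compensatedIntegral]
  change _ * ‖realCoord e k _‖ₑ ≤ _
  rw [map_sub]
  refine (mul_le_mul' le_rfl enorm_sub_le).trans ?_
  rw [mul_add]
  exact add_le_add (key n hn hnfin) (key Λ hΛ hΛfin)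

/-- A path of a mild solution stays close to the semigroup as long as `ε` times the mass of the
jumps is small. -/
lemma norm_sub_semigroup_le (hA : IsNegativeWithEigenbasis A e lam)
    (hS : IsC0SemigroupGeneratedBy S A) {n Λ : Measure (ℝ≥0 × HilbertSchmidt e)}
    (hn : ∀ᵐ p ∂n, p.2.IsDiagonal) (hΛ : ∀ᵐ p ∂Λ, p.2.IsDiagonal)
    {x : ℝ≥0 → H} (hx : IsCadlagPath x) {T : ℝ≥0} {η ε : ℝ} (hε : 0 < ε)
    (hnfin : n (Ioc 0 T ×ˢ HilbertSchmidt.annulus e η) ≠ ∞)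
    (hΛfin : Λ (Ioc 0 T ×ˢ HilbertSchmidt.annulus e η) ≠ ∞) {h : H}
    (hmild : ∀ t, x t = S t h + ε •
      compensatedIntegral n Λ (Ioc 0 t ×ˢ HilbertSchmidt.annulus e η)
        (fun p => S (t - p.1) (p.2.toCLM (Function.leftLim x p.1)))) :
    ‖x T - S T h‖ ≤ (Real.exp (2 * ε * (n.real (Ioc 0 T ×ˢ HilbertSchmidt.annulus e η) +
      Λ.real (Ioc 0 T ×ˢ HilbertSchmidt.annulus e η))) - 1) * ‖S T h‖ := by
  set μ := jumpTimeMeasure η n Λ with hμdef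
  have hμ : μ (Ioc 0 T) ≠ ∞ := by
    rw [hμdef, jumpTimeMeasure_Ioc]
    exact ENNReal.add_ne_top.2 ⟨hnfin, hΛfin⟩
  have hμr : μ.real (Ioc 0 T) = n.real (Ioc 0 T ×ˢ HilbertSchmidt.annulus e η) +
      Λ.real (Ioc 0 T ×ˢ HilbertSchmidt.annulus e η) := by
    rw [measureReal_def, hμdef, jumpTimeMeasure_Ioc, ENNReal.toReal_add hnfin hΛfin]
    rfl
  rw [← hμr]
  have hG : 0 ≤ Real.exp (2 * ε * μ.real (Ioc 0 T)) - 1 :=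
    sub_nonneg.2 (Real.one_le_exp (mul_nonneg (by positivity) measureReal_nonneg))
  -- The Gronwall factor is the same for every coordinate, so the estimate may be proved
  -- coordinatewise.
  refine e.norm_le_mul_of_inner hG fun k => ?_
  set u : ℝ≥0 → ℝ := fun s => Real.exp (lam k * s) * ‖⟪e k, x s⟫_𝕜‖ with hudef
  set g : ℝ≥0 → ℝ := fun s => Real.exp (lam k * s) * ‖⟪e k, Function.leftLim x s⟫_𝕜‖ with hgdef
  have hdist : ∀ t ≤ T, ENNReal.ofReal (Real.exp (lam k * t) * ‖⟪e k, x t - S t h⟫_𝕜‖) ≤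
      ENNReal.ofReal ε * ∫⁻ s in Ioc 0 t, ENNReal.ofReal (g s) ∂μ := by
    intro t ht
    have hsub : Ioc 0 t ×ˢ HilbertSchmidt.annulus e η ⊆ Ioc 0 T ×ˢ HilbertSchmidt.annulus e η :=
      Set.prod_mono (Ioc_subset_Ioc_right ht) Subset.rfl
    have h1 := enorm_inner_compensatedIntegral_le hA hS hn hΛ hx t (η := η)
      (ne_top_of_le_ne_top hnfin (measure_mono hsub))
      (ne_top_of_le_ne_top hΛfin (measure_mono hsub)) k
    have h2 : x t - S t h = ε • compensatedIntegral n Λ (Ioc 0 t ×ˢ HilbertSchmidt.annulus e η)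
        (fun p => S (t - p.1) (p.2.toCLM (Function.leftLim x p.1))) := by
      rw [sub_eq_iff_eq_add', ← hmild t]
    rw [h2, inner_real_smul, norm_mul, RCLike.norm_ofReal, abs_of_pos hε, mul_left_comm,
      ENNReal.ofReal_mul hε.le, ENNReal.ofReal_mul (Real.exp_pos _).le, ofReal_norm]
    exact mul_le_mul' le_rfl h1
  have hinit : ∀ t : ℝ≥0, Real.exp (lam k * t) * ‖⟪e k, S t h⟫_𝕜‖ = ‖⟪e k, h⟫_𝕜‖ := by
    intro t
    rw [hS.inner_apply hA, norm_mul, RCLike.norm_ofReal, abs_of_pos (Real.exp_pos _), ← mul_assoc,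
      ← Real.exp_add]
    simp
  obtain ⟨R, hR0, hR⟩ := hx.exists_norm_le T
  have hinner : ∀ y : H, ‖⟪e k, y⟫_𝕜‖ ≤ ‖y‖ := fun y => by
    simpa [e.orthonormal.1 k] using norm_inner_le_norm (𝕜 := 𝕜) (e k) y
  have hgron := gronwall_left_limits μ T hμ u g (C := ‖⟪e k, h⟫_𝕜‖) (ε := ε)
    (R := Real.exp (lam k * T) * R) ?_ ?_ (norm_nonneg _) hε (fun s => by positivity) ?_
  · have h1 := (hdist T le_rfl).trans hgron
    rw [ENNReal.ofReal_le_ofReal_iff (mul_nonneg (norm_nonneg _) hG), ← hinit T] at h1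
    refine le_of_mul_le_mul_left ?_ (Real.exp_pos (lam k * T))
    linarith
  · intro s hs K hK
    have : (𝓝[<] s).NeBot := nhdsLT_neBot_of_exists_lt ⟨0, hs.1⟩
    have h1 : Tendsto u (𝓝[<] s) (𝓝 (g s)) := by
      have hc : Continuous fun s : ℝ≥0 => Real.exp (lam k * s) := by fun_prop
      exact ((hc.tendsto s).mono_left nhdsWithin_le_nhds).mul
        (((innerSL 𝕜 (e k)).continuous.tendsto _).comp (hx.tendsto_leftLim s)).norm
    refine le_of_tendsto h1 ?_
    filter_upwards [self_mem_nhdsWithin] with r hr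
    exact hK r hr
  · intro s hs
    have := (hA.pos' k).le
    refine mul_le_mul ?_ ((hinner _).trans (hR s hs)) (norm_nonneg _) (Real.exp_pos _).le
    gcongr
  · intro t ht
    refine le_trans ?_ (add_le_add_right (hdist t ht) _)
    rw [← ENNReal.ofReal_add (norm_nonneg _) (by positivity), ← hinit t, ← mul_add]
    refine ENNReal.ofReal_le_ofReal (mul_le_mul_of_nonneg_left ?_ (Real.exp_pos _).le)
    refine le_trans (le_of_eq ?_) (norm_add_le _ _)
    rw [← inner_add_right, add_sub_cancel]

end Pathwise

/-! ### Second moments of the mild solution -/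

section Moments

variable {𝕜 H Ω : Type*} [RCLike 𝕜] [NormedAddCommGroup H] [InnerProductSpace 𝕜 H]
  {e : HilbertBasis ℕ 𝕜 H} {ν : Measure (HilbertSchmidt e)} [MeasurableSpace Ω] {P : Measure Ω}
  {𝓕 : Filtration ℝ≥0 ‹MeasurableSpace Ω›} {N : Ω → Measure (ℝ≥0 × HilbertSchmidt e)}

lemma ae_isDiagonal_prod (hν : IsLevyMeasure ν) (hdiag : ν.support ⊆ {z | z.IsDiagonal}) :
    (timeMeasure.prod ν) (univ ×ˢ {z : HilbertSchmidt e | z.IsDiagonal}ᶜ) = 0 := by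
  have := HilbertSchmidt.secondCountableTopology e
  have := hν.sFinite
  have h : ν {z | z.IsDiagonal}ᶜ = 0 := mem_of_superset (Measure.support_mem_ae (μ := ν)) hdiag
  rw [Measure.prod_prod, h, mul_zero]

lemma IsPoissonRandomMeasure.ae_isDiagonal (hN : IsPoissonRandomMeasure P 𝓕 ν N)
    (hν : IsLevyMeasure ν) (hdiag : ν.support ⊆ {z | z.IsDiagonal}) :
    ∀ᵐ ω ∂P, ∀ᵐ p ∂(N ω), p.2.IsDiagonal := by
  filter_upwards [hN.ae_eq_zero (MeasurableSet.univ.prod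
    HilbertSchmidt.isClosed_isDiagonal.measurableSet.compl) (ae_isDiagonal_prod hν hdiag)] with ω hω
  rw [ae_iff]
  refine measure_mono_null (fun p hp => ?_) hω
  exact ⟨trivial, hp⟩

lemma prod_Ioc_annulus (hν : IsLevyMeasure ν) (η : ℝ) (t : ℝ≥0) :
    (timeMeasure.prod ν) (Ioc 0 t ×ˢ HilbertSchmidt.annulus e η) =
      t * ν (HilbertSchmidt.annulus e η) := by
  have := hν.sFinite
  rw [Measure.prod_prod, timeMeasure_Ioc]

lemma prod_Ioc_annulus_ne_top (hν : IsLevyMeasure ν) {η : ℝ} (hη : 0 < η) (t : ℝ≥0) :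
    (timeMeasure.prod ν) (Ioc 0 t ×ˢ HilbertSchmidt.annulus e η) ≠ ∞ := by
  rw [prod_Ioc_annulus hν]
  exact ENNReal.mul_ne_top ENNReal.coe_ne_top (hν.measure_annulus_ne_top hη)

/-- The summand `b` in the exponent comes from the deterministic compensator, and `exp b - 1` from
the Poisson moment generating function. -/
lemma lintegral_exp_mul_jumps (hN : IsPoissonRandomMeasure P 𝓕 ν N) (hν : IsLevyMeasure ν) {η : ℝ}
    (hη : 0 < η) (t : ℝ≥0) (b : ℝ) :
    ∫⁻ ω, ENNReal.ofReal (Real.exp (b *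
        ((N ω).real (Ioc 0 t ×ˢ HilbertSchmidt.annulus e η) +
          (timeMeasure.prod ν).real (Ioc 0 t ×ˢ HilbertSchmidt.annulus e η)))) ∂P =
      ENNReal.ofReal (Real.exp (t * ν.real (HilbertSchmidt.annulus e η) *
        (b + (Real.exp b - 1)))) := by
  have hB : MeasurableSet (Ioc 0 t ×ˢ HilbertSchmidt.annulus e η) :=
    measurableSet_Ioc.prod (HilbertSchmidt.measurableSet_annulus η)
  have hr : (timeMeasure.prod ν).real (Ioc 0 t ×ˢ HilbertSchmidt.annulus e η) =
      t * ν.real (HilbertSchmidt.annulus e η) := by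
    rw [measureReal_def, prod_Ioc_annulus hν, ENNReal.toReal_mul]
    rfl
  simp_rw [mul_add b, Real.exp_add, ENNReal.ofReal_mul (Real.exp_pos _).le]
  rw [lintegral_mul_const' _ _ ENNReal.ofReal_ne_top]
  have h := hN.lintegral_exp_mul hB (prod_Ioc_annulus_ne_top hν hη t) b
  simp only [← measureReal_def] at h
  rw [h, ← ENNReal.ofReal_mul (Real.exp_pos _).le, ← Real.exp_add, hr]
  congr 2
  ring

variable [NormedSpace ℝ H] [CompleteSpace H] {A : H →ₗ.[𝕜] H}
  {lam : ℕ → ℝ} {S : ℝ≥0 → H →L[𝕜] H} {η ε : ℝ} {X : ℝ≥0 → Ω → H →L[𝕜] H}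

lemma IsMildSolution.ae_norm_sub_le (hX : IsMildSolution P 𝓕 S ν N η ε X)
    (hA : IsNegativeWithEigenbasis A e lam) (hS : IsC0SemigroupGeneratedBy S A)
    (hN : IsPoissonRandomMeasure P 𝓕 ν N) (hν : IsLevyMeasure ν)
    (hdiag : ν.support ⊆ {z | z.IsDiagonal}) (hη : 0 < η) (hε : 0 < ε) (t : ℝ≥0) (h : H) :
    ∀ᵐ ω ∂P, ‖X t ω h - S t h‖ ≤
      (Real.exp (2 * ε * ((N ω).real (Ioc 0 t ×ˢ HilbertSchmidt.annulus e η) +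
        (timeMeasure.prod ν).real (Ioc 0 t ×ˢ HilbertSchmidt.annulus e η))) - 1) * ‖S t h‖ := by
  have hΛfin := prod_Ioc_annulus_ne_top hν hη t
  have hΛ : ∀ᵐ p ∂(timeMeasure.prod ν), p.2.IsDiagonal := by
    rw [ae_iff]
    refine measure_mono_null (fun p hp => ?_) (ae_isDiagonal_prod hν hdiag)
    exact ⟨trivial, hp⟩
  filter_upwards [hX.cadlag, hX.mild, hN.ae_isDiagonal hν hdiag, hN.ae_lt_top
    (measurableSet_Ioc.prod (HilbertSchmidt.measurableSet_annulus η)) hΛfin]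
    with ω hcadlag hmild hn hnfin
  exact norm_sub_semigroup_le hA hS hn hΛ (hcadlag h) hε hnfin.ne hΛfin fun t => hmild t h

lemma IsMildSolution.lintegral_sq_le (hX : IsMildSolution P 𝓕 S ν N η ε X)
    (hA : IsNegativeWithEigenbasis A e lam) (hS : IsC0SemigroupGeneratedBy S A)
    (hN : IsPoissonRandomMeasure P 𝓕 ν N) (hν : IsLevyMeasure ν)
    (hdiag : ν.support ⊆ {z | z.IsDiagonal}) (hη : 0 < η) (hε : 0 < ε) (t : ℝ≥0) (h : H) :
    ∫⁻ ω, ENNReal.ofReal (‖X t ω h‖ ^ 2) ∂P ≤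
      ENNReal.ofReal (‖S t h‖ ^ 2 * Real.exp (t * ν.real (HilbertSchmidt.annulus e η) *
        (4 * ε + (Real.exp (4 * ε) - 1)))) := by
  rw [ENNReal.ofReal_mul (by positivity), ← lintegral_exp_mul_jumps hN hν hη t (4 * ε),
    ← lintegral_const_mul' _ _ ENNReal.ofReal_ne_top]
  refine lintegral_mono_ae ?_
  filter_upwards [hX.ae_norm_sub_le hA hS hN hν hdiag hη hε t h] with ω hω
  rw [← ENNReal.ofReal_mul (by positivity)]
  refine ENNReal.ofReal_le_ofReal ?_
  set y := (N ω).real (Ioc 0 t ×ˢ HilbertSchmidt.annulus e η) +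
    (timeMeasure.prod ν).real (Ioc 0 t ×ˢ HilbertSchmidt.annulus e η)
  have h1 : ‖X t ω h‖ ≤ ‖S t h‖ * Real.exp (2 * ε * y) := by
    have := norm_le_norm_add_norm_sub' (X t ω h) (S t h)
    linarith
  have h2 : Real.exp (4 * ε * y) = Real.exp (2 * ε * y) ^ 2 := by
    rw [← Real.exp_nat_mul]
    congr 1
    push_cast
    ring
  rw [h2, ← mul_pow]
  gcongr

lemma IsMildSolution.le_lintegral_sq [IsProbabilityMeasure P]
    (hX : IsMildSolution P 𝓕 S ν N η ε X)
    (hA : IsNegativeWithEigenbasis A e lam) (hS : IsC0SemigroupGeneratedBy S A)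
    (hN : IsPoissonRandomMeasure P 𝓕 ν N) (hν : IsLevyMeasure ν)
    (hdiag : ν.support ⊆ {z | z.IsDiagonal}) (hη : 0 < η) (hε : 0 < ε) (t : ℝ≥0) (h : H) :
    ENNReal.ofReal (‖S t h‖ ^ 2 * (3 - 2 * Real.exp (t * ν.real (HilbertSchmidt.annulus e η) *
        (2 * ε + (Real.exp (2 * ε) - 1))))) ≤ ∫⁻ ω, ENNReal.ofReal (‖X t ω h‖ ^ 2) ∂P := by
  -- With `G = exp (2 ε Y)` this integrates the pointwise bound `3 ‖S t h‖² ≤ ‖X‖² + 2 ‖S t h‖² G`,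
  -- stated additively so that every integrand is nonnegative.
  have hsum : ENNReal.ofReal (3 * ‖S t h‖ ^ 2) ≤ (∫⁻ ω, ENNReal.ofReal (‖X t ω h‖ ^ 2) ∂P) +
      ENNReal.ofReal (2 * ‖S t h‖ ^ 2 * Real.exp (t * ν.real (HilbertSchmidt.annulus e η) *
        (2 * ε + (Real.exp (2 * ε) - 1)))) := by
    have hm : Measurable fun ω => (N ω).real (Ioc 0 t ×ˢ HilbertSchmidt.annulus e η) :=
      (hN.measurable _ (measurableSet_Ioc.prod
        (HilbertSchmidt.measurableSet_annulus η))).ennreal_toReal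
    rw [ENNReal.ofReal_mul (q := Real.exp _) (by positivity),
      ← lintegral_exp_mul_jumps hN hν hη t (2 * ε),
      ← lintegral_const_mul' _ _ ENNReal.ofReal_ne_top, ← lintegral_add_right _ (by fun_prop)]
    calc ENNReal.ofReal (3 * ‖S t h‖ ^ 2) = ∫⁻ _, ENNReal.ofReal (3 * ‖S t h‖ ^ 2) ∂P := by simp
      _ ≤ _ := ?_
    refine lintegral_mono_ae ?_
    filter_upwards [hX.ae_norm_sub_le hA hS hN hν hdiag hη hε t h] with ω hω
    rw [← ENNReal.ofReal_mul (by positivity), ← ENNReal.ofReal_add (by positivity) (by positivity)]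
    refine ENNReal.ofReal_le_ofReal ?_
    set G := Real.exp (2 * ε * ((N ω).real (Ioc 0 t ×ˢ HilbertSchmidt.annulus e η) +
      (timeMeasure.prod ν).real (Ioc 0 t ×ˢ HilbertSchmidt.annulus e η)))
    have h1 : ‖S t h‖ * (2 - G) ≤ ‖X t ω h‖ := by
      have h2 := norm_le_norm_add_norm_sub' (S t h) (X t ω h)
      rw [norm_sub_rev] at h2
      linarith
    -- For `G ≤ 2`, square `‖S t h‖ (2 - G) ≤ ‖X‖` and use `(2 - G)² = 3 - 2 G + (G - 1)²`. For `G >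
    -- 2` the term `2 G` alone exceeds `3`.
    rcases le_or_gt G 2 with hG | hG
    · have h2 : (‖S t h‖ * (2 - G)) ^ 2 ≤ ‖X t ω h‖ ^ 2 :=
        pow_le_pow_left₀ (mul_nonneg (norm_nonneg _) (by linarith)) h1 2
      nlinarith [sq_nonneg (‖S t h‖ * (G - 1))]
    · nlinarith [sq_nonneg ‖S t h‖, sq_nonneg ‖X t ω h‖]
  refine le_trans (le_of_eq ?_) (tsub_le_iff_right.2 hsum)
  rw [← ENNReal.ofReal_sub _ (by positivity)]
  congr 1
  ring

end Moments

/-! ### The cutoff -/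

/-- The last factor of the exponent is `ε` times `b` plus a difference quotient tending to `b`. The
remaining `ε * τ ε` drives the exponent to `0`. -/
lemma tendsto_exp_mul_error {τ : ℝ → ℝ} (hτ : Tendsto (fun ε => ε * τ ε) (𝓝[>] 0) (𝓝 0))
    (κ b : ℝ) :
    Tendsto (fun ε => Real.exp (τ ε * κ * (b * ε + (Real.exp (b * ε) - 1)))) (𝓝[>] 0) (𝓝 1) := by
  have hd : HasDerivAt (fun x => Real.exp (b * x)) b 0 := by
    simpa using ((hasDerivAt_id (0 : ℝ)).const_mul b).exp
  have h1 := hd.tendsto_slope_zero_right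
  simp only [zero_add, mul_zero, Real.exp_zero, smul_eq_mul] at h1
  have h2 := (hτ.mul_const κ).mul ((tendsto_const_nhds (x := b)).add h1)
  rw [zero_mul, zero_mul] at h2
  have h3 := (Real.continuous_exp.tendsto 0).comp h2
  rw [Real.exp_zero] at h3
  refine h3.congr' ?_
  filter_upwards [self_mem_nhdsWithin] with ε hε
  have hε' : ε ≠ 0 := ne_of_gt hε
  simp only [Function.comp_apply]
  congr 1
  field_simp

theorem theorem5p7 {𝕜 H Ω : Type*} [RCLike 𝕜] [NormedAddCommGroup H] [InnerProductSpace 𝕜 H]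
    [NormedSpace ℝ H] [CompleteSpace H] [MeasurableSpace H] [BorelSpace H]
    (A : H →ₗ.[𝕜] H) (e : HilbertBasis ℕ 𝕜 H) (lam : ℕ → ℝ)
    (hA : IsNegativeWithEigenbasis A e lam)
    (S : ℝ≥0 → H →L[𝕜] H) (hS : IsC0SemigroupGeneratedBy S A)
    (ν : Measure (HilbertSchmidt e)) (hν : IsLevyMeasure ν)
    (hdiag : ν.support ⊆ {z | z.IsDiagonal})
    [MeasurableSpace Ω] (P : Measure Ω) [IsProbabilityMeasure P]
    (𝓕 : Filtration ℝ≥0 ‹MeasurableSpace Ω›) (h𝓕 : UsualConditions P 𝓕)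
    (N : Ω → Measure (ℝ≥0 × HilbertSchmidt e)) (hN : IsPoissonRandomMeasure P 𝓕 ν N)
    (η : ℝ) (hη : η ∈ Set.Ioo (0 : ℝ) 1)
    (X : ℝ → ℝ≥0 → Ω → H →L[𝕜] H)
    (hX : ∀ ε ∈ Set.Ioo (0 : ℝ) 1, IsMildSolution P 𝓕 S ν N η ε (X ε))
    (h : H) (hdom : h ∈ A.domain) (h0 : h ≠ 0) :
    leadingVector e lam h ≠ 0 ∧
    Tendsto (fun t : ℝ≥0 => Real.exp (t * lam (leadingIndex e h)) • S t h) atTop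
      (𝓝 (leadingVector e lam h)) ∧
    ∀ a : ℝ → ℝ, (∀ ε ∈ Set.Ioo (0 : ℝ) 1, 0 < a ε) →
      Tendsto a (𝓝[>] 0) (𝓝 0) → Tendsto (fun ε => ε * |Real.log (a ε)|) (𝓝[>] 0) (𝓝 0) →
      ∀ ρ : ℝ,
        Tendsto
          (fun ε => wassersteinDist 2
              (P.map fun ω => X ε (1 / lam (leadingIndex e h) * |Real.log (a ε)| + ρ).toNNReal ω h)
              (Measure.dirac 0) / ENNReal.ofReal (a ε))
          (𝓝[>] 0)
          (𝓝 (ENNReal.ofReal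
            (Real.exp (-lam (leadingIndex e h) * ρ) * ‖leadingVector e lam h‖))) := by
  refine ⟨hA.leadingVector_ne_zero h0, hS.tendsto_leadingVector hA h, ?_⟩
  intro a ha0 ha hεa ρ
  set L := lam (leadingIndex e h) with hL
  have hLpos : 0 < L := hA.pos' _
  set v := leadingVector e lam h with hv
  set τ : ℝ → ℝ≥0 := fun ε => (1 / L * |Real.log (a ε)| + ρ).toNNReal with hτdef
  have hIoo : ∀ᶠ ε in 𝓝[>] (0 : ℝ), ε ∈ Ioo (0 : ℝ) 1 := Ioo_mem_nhdsGT one_pos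
  have hlog : Tendsto (fun ε => Real.log (a ε)) (𝓝[>] 0) atBot :=
    Real.tendsto_log_nhdsGT_zero.comp
      (tendsto_nhdsWithin_iff.2 ⟨ha, hIoo.mono fun ε hε => ha0 ε hε⟩)
  have harg : Tendsto (fun ε => 1 / L * |Real.log (a ε)| + ρ) (𝓝[>] 0) atTop :=
    tendsto_atTop_add_const_right _ _
      ((tendsto_abs_atBot_atTop.comp hlog).const_mul_atTop (by positivity))
  have hτ : Tendsto τ (𝓝[>] 0) atTop := tendsto_real_toNNReal_atTop.comp harg
  -- The truncation of negative times at `0` is inactive for small `ε`.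
  have hτval : ∀ᶠ ε in 𝓝[>] (0 : ℝ), (τ ε : ℝ) = 1 / L * |Real.log (a ε)| + ρ := by
    filter_upwards [harg.eventually_ge_atTop 0] with ε hε
    exact Real.coe_toNNReal _ hε
  have hετ : Tendsto (fun ε => ε * (τ ε : ℝ)) (𝓝[>] 0) (𝓝 0) := by
    have h1 : Tendsto (fun ε : ℝ => ε) (𝓝[>] 0) (𝓝 0) := nhdsWithin_le_nhds
    have h2 := (hεa.const_mul (1 / L)).add (h1.mul_const ρ)
    rw [mul_zero, zero_mul, add_zero] at h2
    refine h2.congr' ?_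
    filter_upwards [hτval] with ε hε
    rw [hε]
    ring
  have hscale : Tendsto (fun ε => ‖S (τ ε) h‖ / a ε) (𝓝[>] 0) (𝓝 (Real.exp (-L * ρ) * ‖v‖)) := by
    refine ((((hS.tendsto_leadingVector hA h).comp hτ).norm).const_mul (Real.exp (-L * ρ))).congr' ?_
    filter_upwards [hτval, hIoo, hlog.eventually_le_atBot 0] with ε hε hε1 hlog0
    simp only [Function.comp_apply]
    rw [norm_smul, Real.norm_of_nonneg (Real.exp_pos _).le, ← mul_assoc, ← Real.exp_add, ← hL, hε,
      abs_of_nonpos hlog0]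
    -- For `a ε ≤ 1` the time is `-log (a ε) / L + ρ`, so the exponential rescaling is exactly
    -- division by `a ε`.
    have h1 : -L * ρ + (1 / L * -Real.log (a ε) + ρ) * L = -Real.log (a ε) := by
      field_simp
      ring
    rw [h1, Real.exp_neg, Real.exp_log (ha0 ε hε1)]
    ring
  set κ := ν.real (HilbertSchmidt.annulus e η) with hκ
  have hUp := tendsto_exp_mul_error hετ κ 4
  have hLow := tendsto_exp_mul_error hετ κ 2
  have hU : Tendsto (fun ε => ENNReal.ofReal ((‖S (τ ε) h‖ / a ε) ^ 2 *
      Real.exp (τ ε * κ * (4 * ε + (Real.exp (4 * ε) - 1))))) (𝓝[>] 0)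
      (𝓝 (ENNReal.ofReal ((Real.exp (-L * ρ) * ‖v‖) ^ 2))) := by
    refine (ENNReal.continuous_ofReal.tendsto _).comp ?_
    simpa using (hscale.pow 2).mul hUp
  have hV : Tendsto (fun ε => ENNReal.ofReal ((‖S (τ ε) h‖ / a ε) ^ 2 *
      (3 - 2 * Real.exp (τ ε * κ * (2 * ε + (Real.exp (2 * ε) - 1)))))) (𝓝[>] 0)
      (𝓝 (ENNReal.ofReal ((Real.exp (-L * ρ) * ‖v‖) ^ 2))) := by
    refine (ENNReal.continuous_ofReal.tendsto _).comp ?_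
    have h1 := (hscale.pow 2).mul ((tendsto_const_nhds (x := (3 : ℝ))).sub (hLow.const_mul 2))
    convert! h1 using 2
    norm_num
  -- Squeeze between the two moment bounds: their correction factors tend to `1` and to `3 - 2 * 1 =
  -- 1`.
  have hQ : Tendsto (fun ε => (∫⁻ ω, ENNReal.ofReal (‖X ε (τ ε) ω h‖ ^ 2) ∂P) /
      ENNReal.ofReal (a ε ^ 2)) (𝓝[>] 0) (𝓝 (ENNReal.ofReal ((Real.exp (-L * ρ) * ‖v‖) ^ 2))) := by
    refine tendsto_of_tendsto_of_tendsto_of_le_of_le' hV hU ?_ ?_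
    · filter_upwards [hIoo] with ε hε
      have h1 := (hX ε hε).le_lintegral_sq hA hS hN hν hdiag hη.1 hε.1 (τ ε) h
      have hpos := pow_pos (ha0 ε hε) 2
      rw [div_pow, div_mul_eq_mul_div, ENNReal.ofReal_div_of_pos hpos]
      exact ENNReal.div_le_div_right h1 _
    · filter_upwards [hIoo] with ε hε
      have h1 := (hX ε hε).lintegral_sq_le hA hS hN hν hdiag hη.1 hε.1 (τ ε) h
      have hpos := pow_pos (ha0 ε hε) 2
      rw [div_pow, div_mul_eq_mul_div, ENNReal.ofReal_div_of_pos hpos]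
      exact ENNReal.div_le_div_right h1 _
  have hsqrt : ∀ x : ℝ, 0 ≤ x → ENNReal.ofReal (x ^ 2) ^ (1 / 2 : ℝ) = ENNReal.ofReal x := by
    intro x hx
    rw [ENNReal.ofReal_rpow_of_nonneg (by positivity) (by norm_num), ← Real.sqrt_eq_rpow,
      Real.sqrt_sq hx]
  have hfinal := ((ENNReal.continuous_rpow_const (y := 1 / 2)).tendsto _).comp hQ
  rw [hsqrt _ (by positivity)] at hfinal
  refine hfinal.congr' ?_
  filter_upwards [hIoo] with ε hε
  have hmeas : Measurable fun ω => X ε (τ ε) ω h :=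
    (((hX ε hε).adapted h (τ ε)).mono (𝓕.le _)).measurable
  have : IsProbabilityMeasure (P.map fun ω => X ε (τ ε) ω h) :=
    Measure.isProbabilityMeasure_map hmeas.aemeasurable
  simp only [Function.comp_apply]
  rw [wassersteinDist_two_dirac_zero, lintegral_map (by fun_prop) hmeas,
    ENNReal.div_rpow_of_nonneg _ _ (by norm_num), hsqrt _ (ha0 ε hε).le]
  congr 3
  ext ω
  rw [← ofReal_norm, ENNReal.rpow_ofNat, ENNReal.ofReal_pow (norm_nonneg _)]
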